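/- Let $d\ge 1$. For $z=(x,\omega)\in\mathbb R^{2d}$ let $\pi(z)$ be the time-frequency shift $\pi(z)\psi(t)=e^{2\pi i\omega\cdot t}\psi(t-x)$ on $L^2(\mathbb R^d)$, let $P\psi(t)=\psi(-t)$, and for bounded operators $A$ on $L^2(\mathbb R^d)$ put $\alpha_z(A)=\pi(z)A\pi(z)^*$ and $\check A=PAP$. For trace class operators $S,T$ and $f\in L^1(\mathbb R^{2d})$ define the function $S\star T(z)=\mathrm{tr}(S\,\alpha_z(\check T))$ and the operator $f\star S=\int_{\mathbb R^{2d}}f(z)\,\alpha_z(S)\,dz$ (weak integral). Write $\tilde S=S\star\check S$, let $Q_S(\psi)=\check S\star(\psi\otimes\psi)$ with $(\psi\otimes\psi)(\xi)=\langle\xi,\psi\rangle\psi$, and let $$M^*_{op}=\Big\{S\text{ trace class on }L^2(\mathbb R^d):\ S\ge 0,\ \mathrm{tr}(S)=1,\ \int_{\mathbb R^{2d}}\tilde S(z)\,|z|\,dz<\infty\Big\},$$ where $|z|$ is the Euclidean norm. For $R>0$ let $B=B(0,R)\subset\mathbb R^{2d}$ be the open Euclidean ball with centre $0$ and radius $R$,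 with Lebesgue measure $|B|$ and characteristic function $\chi_B$. **Theorem (Sharpness).** Let $S\in M^*_{op}$. There exist constants $C_S^1,C_S^2>0$, depending only on $d$ and $S$, such that for every $R>1$ the following holds. The mixed-state localization operator has a spectral representation $\chi_{B(0,R)}\star S=\sum_{k\ge1}\lambda_k\,h_k\otimes h_k$, convergent in operator norm, with $\lambda_1\ge\lambda_2\ge\cdots$ and $(h_k)_{k\ge1}$ an orthonormal sequence in $L^2(\mathbb R^d)$; and for every such representation the accumulated Cohen class distribution $$\rho^S_{B(0,R)}=\sum_{k=1}^{\lceil |B(0,R)|\rceil}Q_S(h_k)$$ satisfies $\rho^S_{B(0,R)}-\chi_{B(0,R)}\in L^1(\mathbb R^{2d})$ and $$C_S^1R^{2d-1}\ \le\ \big\|\rho^S_{B(0,R)}-\chi_{B(0,R)}\big\|_{L^1(\mathbb R^{2d})}\ \le\ C_S^2R^{2d-1}.$$ -/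

import Mathlib

open MeasureTheory Filter Topology
open scoped InnerProductSpace ENNReal

noncomputable section

/-! ### Trace class operators on a complex Hilbert space -/

section Trace

variable {H : Type*} [NormedAddCommGroup H] [InnerProductSpace ℂ H] [CompleteSpace H]

/-- The index set of a fixed orthonormal basis of `H`. -/
def onbIndex (H : Type*) [NormedAddCommGroup H] [InnerProductSpace ℂ H] [CompleteSpace H] :
    Set H :=
  (exists_hilbertBasis ℂ H).choose

/-- A fixed orthonormal basis of `H`. -/
def onb (H : Type*) [NormedAddCommGroup H] [InnerProductSpace ℂ H] [CompleteSpace H] :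
    HilbertBasis (onbIndex H) ℂ H :=
  (exists_hilbertBasis ℂ H).choose_spec.choose

/-- The trace `tr A = ∑ₑ ⟨A e, e⟩` (Mathlib's inner product is antilinear in its first slot).
For trace class operators the value does not depend on the orthonormal basis. -/
def opTrace (A : H →L[ℂ] H) : ℂ :=
  ∑' i, ⟪onb H i, A (onb H i)⟫_ℂ

/-- `A` is trace class: `A` is compact and `tr |A| = ∑ₑ ⟨|A| e, e⟩ < ∞`,
with `|A| = (A⋆ A)^(1/2)`. -/
def IsTraceClass (A : H →L[ℂ] H) : Prop :=
  IsCompactOperator A ∧ Summable fun i => ⟪onb H i, CFC.abs A (onb H i)⟫_ℂ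

/-- A spectral representation `T = ∑ₖ λₖ hₖ ⊗ hₖ`, convergent in operator norm, with `(hₖ)`
an orthonormal sequence and the eigenvalues arranged in decreasing order, with multiplicity.
(The sequence `(hₖ)` need not be complete: if `T` has a kernel and infinitely many nonzero
eigenvalues, then no decreasing enumeration by `ℕ` can exhaust an orthonormal basis.) -/
structure IsSpectralRep (T : H →L[ℂ] H) (lam : ℕ → ℝ) (h : ℕ → H) : Prop where
  antitone : Antitone lam
  orthonormal : Orthonormal ℂ h
  hasSum : HasSum (fun k => (lam k : ℂ) • InnerProductSpace.rankOne ℂ (h k) (h k)) T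

end Trace

/-! ### Time-frequency shifts -/

/-- Position space `ℝᵈ`. -/
abbrev Pos (d : ℕ) : Type := EuclideanSpace ℝ (Fin d)

/-- Phase space `ℝ²ᵈ`, with points `z = (x, ω)`. -/
abbrev Phase (d : ℕ) : Type := EuclideanSpace ℝ (Fin d ⊕ Fin d)

/-- The Hilbert space `L²(ℝᵈ)`. -/
abbrev L2 (d : ℕ) : Type := Lp ℂ 2 (volume : Measure (Pos d))

variable {d : ℕ}

/-- The component `x` of `z = (x, ω)`. -/
def Phase.pos (z : Phase d) : Pos d := WithLp.toLp 2 fun i => z (Sum.inl i)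

/-- The component `ω` of `z = (x, ω)`. -/
def Phase.freq (z : Phase d) : Pos d := WithLp.toLp 2 fun i => z (Sum.inr i)

lemma Phase.continuous_pos : Continuous (Phase.pos (d := d)) := by
  unfold Phase.pos; fun_prop

lemma Phase.continuous_freq : Continuous (Phase.freq (d := d)) := by
  unfold Phase.freq; fun_prop

/-- The translation operator `T_x ψ (t) = ψ (t - x)`. -/
def translation (x : Pos d) : L2 d →L[ℂ] L2 d :=
  (Lp.compMeasurePreservingₗᵢ ℂ (fun t : Pos d => t - x)
    (measurePreserving_sub_right volume x)).toContinuousLinearMap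

/-- The parity operator `P ψ (t) = ψ (-t)`. -/
def parity : L2 d →L[ℂ] L2 d :=
  (Lp.compMeasurePreservingₗᵢ ℂ (fun t : Pos d => -t)
    (Measure.measurePreserving_neg volume)).toContinuousLinearMap

/-- The character `t ↦ exp (2 π i ω · t)`. -/
def tfChar (ω t : Pos d) : ℂ :=
  Complex.exp (2 * Real.pi * Complex.I * (⟪ω, t⟫_ℝ : ℂ))

lemma norm_tfChar (ω t : Pos d) : ‖tfChar ω t‖ = 1 := by
  have : (2 * Real.pi * Complex.I * (⟪ω, t⟫_ℝ : ℂ)) =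
      ((2 * Real.pi * ⟪ω, t⟫_ℝ : ℝ) : ℂ) * Complex.I := by push_cast; ring
  rw [tfChar, this, Complex.norm_exp_ofReal_mul_I]

lemma continuous_tfChar : Continuous fun p : Pos d × Pos d => tfChar p.1 p.2 := by
  unfold tfChar; fun_prop

lemma memLp_tfChar_mul (ω : Pos d) (ψ : L2 d) :
    MemLp (fun t => tfChar ω t * ψ t) 2 (volume : Measure (Pos d)) := by
  have hc : Continuous fun t => tfChar ω t :=
    continuous_tfChar.comp (Continuous.prodMk continuous_const continuous_id)
  refine (memLp_congr_norm (hc.aestronglyMeasurable.mul (Lp.aestronglyMeasurable ψ))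
    (Lp.aestronglyMeasurable ψ) ?_).2 (Lp.memLp ψ)
  exact Eventually.of_forall fun t => by simp [norm_tfChar]

/-- The modulation operator `M_ω ψ (t) = exp (2 π i ω · t) ψ (t)`, as a linear isometry. -/
def modulationIsometry (ω : Pos d) : L2 d →ₗᵢ[ℂ] L2 d where
  toFun ψ := (memLp_tfChar_mul ω ψ).toLp
  map_add' ψ φ := by
    rw [← MemLp.toLp_add]
    refine MemLp.toLp_congr _ _ ?_
    filter_upwards [Lp.coeFn_add ψ φ] with t ht
    simp only [ht, Pi.add_apply, mul_add]
  map_smul' c ψ := by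
    rw [RingHom.id_apply, ← MemLp.toLp_const_smul]
    refine MemLp.toLp_congr _ _ ?_
    filter_upwards [Lp.coeFn_smul c ψ] with t ht
    simp only [ht, Pi.smul_apply, smul_eq_mul]
    ring
  norm_map' ψ := by
    change ‖(memLp_tfChar_mul ω ψ).toLp‖ = ‖ψ‖
    rw [Lp.norm_toLp, Lp.norm_def]
    congr 1
    exact eLpNorm_congr_norm_ae (Eventually.of_forall fun t => by simp [norm_tfChar])

/-- The modulation operator `M_ω ψ (t) = exp (2 π i ω · t) ψ (t)`. -/
def modulation (ω : Pos d) : L2 d →L[ℂ] L2 d :=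
  (modulationIsometry ω).toContinuousLinearMap

/-- The time-frequency shift `π(z) = M_ω T_x` for `z = (x, ω)`. -/
def tfShift (z : Phase d) : L2 d →L[ℂ] L2 d :=
  modulation z.freq ∘L translation z.pos

lemma coeFn_modulation (ω : Pos d) (ψ : L2 d) :
    modulation ω ψ =ᵐ[volume] fun t => tfChar ω t * ψ t :=
  MemLp.coeFn_toLp (memLp_tfChar_mul ω ψ)

lemma coeFn_translation (x : Pos d) (ψ : L2 d) :
    translation x ψ =ᵐ[volume] fun t => ψ (t - x) :=
  Lp.coeFn_compMeasurePreserving ψ (measurePreserving_sub_right volume x)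

lemma norm_modulation (ω : Pos d) (ψ : L2 d) : ‖modulation ω ψ‖ = ‖ψ‖ :=
  (modulationIsometry ω).norm_map ψ

lemma norm_translation (x : Pos d) (ψ : L2 d) : ‖translation x ψ‖ = ‖ψ‖ :=
  Lp.norm_compMeasurePreserving ψ (measurePreserving_sub_right volume x)

lemma norm_tfShift (z : Phase d) (ψ : L2 d) : ‖tfShift z ψ‖ = ‖ψ‖ := by
  simp [tfShift, norm_modulation, norm_translation]

lemma modulation_neg (ω : Pos d) (ψ : L2 d) : modulation ω (modulation (-ω) ψ) = ψ := by
  refine Lp.ext ?_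
  filter_upwards [coeFn_modulation ω (modulation (-ω) ψ), coeFn_modulation (-ω) ψ] with t h1 h2
  rw [h1, h2, ← mul_assoc, tfChar, tfChar, ← Complex.exp_add]
  simp

lemma translation_neg (x : Pos d) (ψ : L2 d) : translation x (translation (-x) ψ) = ψ := by
  refine Lp.ext ?_
  have h2 := (measurePreserving_sub_right (volume : Measure (Pos d)) x).quasiMeasurePreserving.ae
    (coeFn_translation (-x) ψ)
  filter_upwards [coeFn_translation x (translation (-x) ψ), h2] with t h1 h2
  rw [h1, h2]
  simp

lemma tfShift_adjoint_apply (z : Phase d) (ψ : L2 d) :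
    tfShift z ((tfShift z).adjoint ψ) = ψ := by
  obtain ⟨φ, rfl⟩ : ∃ φ, tfShift z φ = ψ :=
    ⟨translation (-z.pos) (modulation (-z.freq) ψ), by
      simp [tfShift, translation_neg, modulation_neg]⟩
  have h : (tfShift z).adjoint ∘L tfShift z = 1 :=
    (ContinuousLinearMap.norm_map_iff_adjoint_comp_self _).1 (norm_tfShift z)
  exact congrArg (tfShift z) (DFunLike.congr_fun h φ)

lemma continuous_translation (ψ : L2 d) : Continuous fun x : Pos d => translation x ψ := by
  let g : Pos d → C(Pos d, Pos d) := fun x => ⟨fun t => t - x, by fun_prop⟩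
  have hg : Continuous g := ContinuousMap.continuous_of_continuous_uncurry _
    (by simp only [g, Function.uncurry_def, ContinuousMap.coe_mk]; fun_prop)
  exact (continuous_const (y := ψ)).compMeasurePreservingLp hg
    (fun x => measurePreserving_sub_right volume x) (by simp)

lemma continuous_modulation (ψ : L2 d) : Continuous fun ω : Pos d => modulation ω ψ := by
  rw [continuous_iff_continuousAt]
  intro ω₀
  have hi : Continuous fun ω : Pos d => ⟪modulation ω₀ ψ, modulation ω ψ⟫_ℂ := by
    have : (fun ω : Pos d => ⟪modulation ω₀ ψ, modulation ω ψ⟫_ℂ) = fun ω =>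
        ∫ t, tfChar ω t * ⟪modulation ω₀ ψ t, ψ t⟫_ℂ := by
      funext ω
      rw [L2.inner_def]
      refine integral_congr_ae ?_
      filter_upwards [coeFn_modulation ω ψ] with t ht
      rw [ht, ← smul_eq_mul, inner_smul_right]
    rw [this]
    have hint := L2.integrable_inner (𝕜 := ℂ) (modulation ω₀ ψ) ψ
    refine continuous_of_dominated (bound := fun t => ‖⟪modulation ω₀ ψ t, ψ t⟫_ℂ‖)
      (fun ω => ?_) (fun ω => ?_) hint.norm ?_
    · have hc : Continuous fun t => tfChar ω t :=
        continuous_tfChar.comp (Continuous.prodMk continuous_const continuous_id)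
      exact hc.aestronglyMeasurable.mul hint.aestronglyMeasurable
    · exact Eventually.of_forall fun t => by rw [norm_mul, norm_tfChar, one_mul]
    · refine Eventually.of_forall fun t => ?_
      have hc : Continuous fun ω => tfChar ω t :=
        continuous_tfChar.comp (Continuous.prodMk continuous_id continuous_const)
      exact hc.mul continuous_const
  rw [ContinuousAt, tendsto_iff_norm_sub_tendsto_zero]
  have hsq : ∀ ω, ‖modulation ω ψ - modulation ω₀ ψ‖ =
      √(2 * ‖ψ‖ ^ 2 - 2 * RCLike.re ⟪modulation ω₀ ψ, modulation ω ψ⟫_ℂ) := by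
    intro ω
    rw [eq_comm, Real.sqrt_eq_iff_eq_sq _ (norm_nonneg _)]
    · rw [norm_sub_rev, @norm_sub_sq ℂ, norm_modulation, norm_modulation]; ring
    · have := sq_nonneg ‖modulation ω₀ ψ - modulation ω ψ‖
      rw [@norm_sub_sq ℂ, norm_modulation, norm_modulation] at this
      linarith
  simp_rw [hsq]
  have hc : Continuous fun ω =>
      √(2 * ‖ψ‖ ^ 2 - 2 * RCLike.re ⟪modulation ω₀ ψ, modulation ω ψ⟫_ℂ) := by
    refine Real.continuous_sqrt.comp (continuous_const.sub (continuous_const.mul ?_))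
    exact RCLike.continuous_re.comp hi
  have h0 := hc.tendsto ω₀
  rwa [← hsq ω₀, sub_self, norm_zero] at h0

lemma continuous_tfShift (ψ : L2 d) : Continuous fun z : Phase d => tfShift z ψ := by
  rw [continuous_iff_continuousAt]
  intro z₀
  rw [ContinuousAt, tendsto_iff_norm_sub_tendsto_zero]
  have h1 : Tendsto (fun z : Phase d => ‖translation z.pos ψ - translation z₀.pos ψ‖) (𝓝 z₀)
      (𝓝 0) := tendsto_iff_norm_sub_tendsto_zero.1
    (((continuous_translation ψ).comp Phase.continuous_pos).tendsto z₀)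
  have h2 : Tendsto (fun z : Phase d => ‖modulation z.freq (translation z₀.pos ψ) -
      modulation z₀.freq (translation z₀.pos ψ)‖) (𝓝 z₀) (𝓝 0) :=
    tendsto_iff_norm_sub_tendsto_zero.1
      (((continuous_modulation (translation z₀.pos ψ)).comp Phase.continuous_freq).tendsto z₀)
  refine squeeze_zero (fun _ => norm_nonneg _) (fun z => ?_) (by simpa using h1.add h2)
  refine (norm_sub_le_norm_sub_add_norm_sub _ (modulation z.freq (translation z₀.pos ψ)) _).trans ?_
  simp only [tfShift, ContinuousLinearMap.comp_apply]
  rw [← map_sub, norm_modulation]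

lemma continuous_tfShift_adjoint (ψ : L2 d) :
    Continuous fun z : Phase d => (tfShift z).adjoint ψ := by
  rw [continuous_iff_continuousAt]
  intro z₀
  rw [ContinuousAt, tendsto_iff_norm_sub_tendsto_zero]
  have h := tendsto_iff_norm_sub_tendsto_zero.1
    ((continuous_tfShift ((tfShift z₀).adjoint ψ)).tendsto z₀)
  refine h.congr fun z => ?_
  rw [tfShift_adjoint_apply, ← norm_tfShift z ((tfShift z).adjoint ψ - (tfShift z₀).adjoint ψ),
    map_sub, tfShift_adjoint_apply, norm_sub_rev]

/-! ### Quantum harmonic analysis -/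

/-- The translate `α_z(A) = π(z) A π(z)⋆` of an operator. -/
def opShift (z : Phase d) (A : L2 d →L[ℂ] L2 d) : L2 d →L[ℂ] L2 d :=
  tfShift z ∘L A ∘L (tfShift z).adjoint

/-- The involution `Ǎ = P A P` of an operator. -/
def opCheck (A : L2 d →L[ℂ] L2 d) : L2 d →L[ℂ] L2 d :=
  parity ∘L A ∘L parity

/-- The convolution `S ⋆ T (z) = tr (S α_z(Ť))` of two operators, a function on phase space. -/
def opConv (S T : L2 d →L[ℂ] L2 d) (z : Phase d) : ℂ :=
  opTrace (S ∘L opShift z (opCheck T))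

lemma norm_opShift_apply_le (A : L2 d →L[ℂ] L2 d) (z : Phase d) (ψ : L2 d) :
    ‖opShift z A ψ‖ ≤ ‖A‖ * ‖ψ‖ := by
  simp only [opShift, ContinuousLinearMap.comp_apply, norm_tfShift]
  refine (A.le_opNorm _).trans_eq ?_
  rw [← norm_tfShift z ((tfShift z).adjoint ψ), tfShift_adjoint_apply]

lemma continuous_opShift_apply (A : L2 d →L[ℂ] L2 d) (ψ : L2 d) :
    Continuous fun z : Phase d => opShift z A ψ := by
  rw [continuous_iff_continuousAt]
  intro z₀
  rw [ContinuousAt, tendsto_iff_norm_sub_tendsto_zero]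
  set φ : Phase d → L2 d := fun z => A ((tfShift z).adjoint ψ) with hφ
  have hφc : Continuous φ := A.continuous.comp (continuous_tfShift_adjoint ψ)
  have h1 := tendsto_iff_norm_sub_tendsto_zero.1 (hφc.tendsto z₀)
  have h2 := tendsto_iff_norm_sub_tendsto_zero.1 ((continuous_tfShift (φ z₀)).tendsto z₀)
  refine squeeze_zero (fun _ => norm_nonneg _) (fun z => ?_) (by simpa using h1.add h2)
  refine (norm_sub_le_norm_sub_add_norm_sub _ (tfShift z (φ z₀)) _).trans ?_
  simp only [opShift, ContinuousLinearMap.comp_apply, hφ]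
  rw [← map_sub, norm_tfShift]

lemma integrable_smul_opShift {f : Phase d → ℂ} (hf : Integrable f) (S : L2 d →L[ℂ] L2 d)
    (ψ : L2 d) : Integrable fun z => f z • opShift z S ψ := by
  refine (hf.norm.mul_const (‖S‖ * ‖ψ‖)).mono'
    (hf.aestronglyMeasurable.smul (continuous_opShift_apply S ψ).aestronglyMeasurable) ?_
  refine Eventually.of_forall fun z => ?_
  rw [norm_smul]
  exact mul_le_mul_of_nonneg_left (norm_opShift_apply_le S z ψ) (norm_nonneg _)

open Classical in
/-- The convolution `f ⋆ S = ∫ f(z) α_z(S) dz` of an integrable function with an operator, acting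
as `ψ ↦ ∫ f(z) α_z(S) ψ dz` (and set to `0` for `f` not integrable). -/
def funConv (f : Phase d → ℂ) (S : L2 d →L[ℂ] L2 d) : L2 d →L[ℂ] L2 d :=
  if hf : Integrable f then
    LinearMap.mkContinuous
      { toFun := fun ψ => ∫ z, f z • opShift z S ψ
        map_add' := fun ψ φ => by
          simp only [map_add, smul_add]
          exact integral_add (integrable_smul_opShift hf S ψ) (integrable_smul_opShift hf S φ)
        map_smul' := fun c ψ => by
          simp only [map_smul, RingHom.id_apply]
          rw [← integral_smul]
          simp only [smul_comm c] }
      ((∫ z, ‖f z‖) * ‖S‖)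
      (fun ψ => by
        refine (norm_integral_le_of_norm_le (hf.norm.mul_const (‖S‖ * ‖ψ‖))
          (Eventually.of_forall fun z => ?_)).trans_eq ?_
        · rw [norm_smul]
          exact mul_le_mul_of_nonneg_left (norm_opShift_apply_le S z ψ) (norm_nonneg _)
        · rw [integral_mul_const, mul_assoc])
  else 0

/-- `f ⋆ S` is the weak integral: `⟨(f ⋆ S) ψ, ξ⟩ = ∫ f(z) ⟨α_z(S) ψ, ξ⟩ dz`. -/
lemma inner_funConv {f : Phase d → ℂ} (hf : Integrable f) (S : L2 d →L[ℂ] L2 d) (ψ ξ : L2 d) :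
    ⟪ξ, funConv f S ψ⟫_ℂ = ∫ z, f z * ⟪ξ, opShift z S ψ⟫_ℂ := by
  have h : funConv f S ψ = ∫ z, f z • opShift z S ψ := by
    rw [funConv, dif_pos hf]; rfl
  rw [h, ← integral_inner (integrable_smul_opShift hf S ψ)]
  simp only [inner_smul_right]

/-! ### Cohen's class distributions -/

/-- The function `S̃ = S ⋆ Š` on phase space. -/
def opTilde (S : L2 d →L[ℂ] L2 d) (z : Phase d) : ℂ := opConv S (opCheck S) z

/-- The set `M*_op` of density operators `S` (positive, trace class, `tr S = 1`) such that
`∫ S̃(z) |z| dz < ∞`. -/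
def MopStar (d : ℕ) : Set (L2 d →L[ℂ] L2 d) :=
  {S | IsTraceClass S ∧ S.IsPositive ∧ opTrace S = 1 ∧
    Integrable fun z : Phase d => opTilde S z * (‖z‖ : ℂ)}

/-- The Cohen class distribution `Q_S(ψ) = Š ⋆ (ψ ⊗ ψ)`. -/
def cohen (S : L2 d →L[ℂ] L2 d) (ψ : L2 d) (z : Phase d) : ℂ :=
  opConv (opCheck S) (InnerProductSpace.rankOne ℂ ψ ψ) z

/-- The characteristic function of `Ω`. -/
def charFn (Ω : Set (Phase d)) : Phase d → ℂ := Ω.indicator 1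

/-- The mixed-state localization operator `χ_Ω ⋆ S`. -/
def locOp (Ω : Set (Phase d)) (S : L2 d →L[ℂ] L2 d) : L2 d →L[ℂ] L2 d :=
  funConv (charFn Ω) S

/-- The accumulated Cohen class distribution: the sum of `Q_S(hₖ)` over the first
`A_Ω = ⌈|Ω|⌉` members of the sequence `h` (the eigenfunctions of `χ_Ω ⋆ S`). -/
def accCohen (S : L2 d →L[ℂ] L2 d) (Ω : Set (Phase d)) (h : ℕ → L2 d) (z : Phase d) : ℂ :=
  ∑ k ∈ Finset.range ⌈volume.real Ω⌉₊, cohen S (h k) z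

end

/-!
Write `S = A²` with `A` self-adjoint, and put `φⱼ = A eⱼ` for the fixed orthonormal basis `(eⱼ)`,
so that `S = ∑ⱼ φⱼ ⊗ φⱼ` and `∑ⱼ ‖φⱼ‖² = tr S = 1`. Then `Q_S(ψ)(z) = ∑ⱼ |⟨π(z) φⱼ, ψ⟩|²`
(`cohen_eq_sqCohen`, `sqCohen_eq_tsum`) and `S̃ = ∑ⱼ Q_S(φⱼ)` (`opTilde_eq_sqTilde`). Moyal's
identity `∫ |⟨π(z) φ, ψ⟩|² dz = ‖φ‖² ‖ψ‖²` (`lintegral_enorm_inner_tfShift_sq`), a consequence of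
Plancherel's theorem, gives `∫ Q_S(ψ) = ‖ψ‖²` and `∫ S̃ = 1`; Bessel's inequality gives
`∑ₖ Q_S(hₖ) ≤ 1` for orthonormal `(hₖ)`.

Let `T = χ_Ω ⋆ S = ∑ₖ λₖ hₖ ⊗ hₖ`. Since `λₖ = ⟨T hₖ, hₖ⟩ = ∫_Ω Q_S(hₖ)` and the accumulated
distribution `ρ` satisfies `0 ≤ ρ ≤ 1`, the distance in the theorem is the number
`N + |Ω| - 2 ∑_{k ≤ N} λₖ` with `N = ⌈|Ω|⌉` (`IsSpectralRep.integral_norm_accCohen_sub`). The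
identity `∑ₖ λₖ Q_S(hₖ) = χ_Ω ∗ S̃` (`IsSpectralRep.tsum_mul_sqCohen`), integrated over the whole
phase space and over the complement of `Ω`, gives `∑ₖ λₖ = |Ω|` and
`∑ₖ λₖ (1 - λₖ) = ∫ S̃(w) |{z ∉ Ω : z + w ∈ Ω}| dw`. An elementary estimate for decreasing
sequences in `[0, 1]` shows that the distance lies between `∑ₖ λₖ (1 - λₖ)` and
`1 + 2 ∑ₖ λₖ (1 - λₖ)` (`tsum_mul_one_sub_le`, `le_two_mul_tsum_mul_one_sub`).

It remains to estimate `|{z ∉ B : z + w ∈ B}|` for the ball `B` of radius `R` in dimension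
`n = 2d`. It is at most `n R^(n-1) |w| |B(0,1)|`, by comparison with a spherical shell
(`measure_notMem_add_mem_ball_le`), which with `∫ S̃(w) |w| dw < ∞` gives the upper bound. It is
subadditive in `w` and equals `|B|` for `|w| ≥ 2R`, hence is at least
`R^(n-1) min(|w|, 1) |B(0,1)| / 3` (`le_measure_notMem_add_mem_ball`), which gives the lower bound
because `S̃ ≥ 0` is not zero almost everywhere.

A spectral representation exists because `T` is positive with `∑ₖ ⟨T hₖ, hₖ⟩ ≤ |Ω|` for every
orthonormal sequence: its square root is a Hilbert–Schmidt operator, so `T` is compact, and the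
eigenvectors can be chosen greedily (`exists_isSpectralRep`).
-/

/-! ### Plancherel's theorem for integrable, square integrable functions -/

open scoped FourierTransform SchwartzMap in
/-- The Fourier transform on `L²`, defined by extension from Schwartz functions, is given by the
Fourier integral on `L¹ ∩ L²`: both represent the same tempered distribution. -/
theorem Lp.coeFn_fourier_toLp {E : Type*} [NormedAddCommGroup E] [InnerProductSpace ℝ E]
    [FiniteDimensional ℝ E] [MeasurableSpace E] [BorelSpace E] {g : E → ℂ}
    (h1 : Integrable g) (h2 : MemLp g 2) :
    (𝓕 (h2.toLp g) : Lp ℂ 2 (volume : Measure E)) =ᵐ[volume] 𝓕 g := by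
  have hc : Continuous (𝓕 g) :=
    VectorFourier.fourierIntegral_continuous Real.continuous_fourierChar continuous_inner h1
  refine ae_eq_of_integral_contDiff_smul_eq ((Lp.memLp _).locallyIntegrable (by norm_num))
    hc.locallyIntegrable fun φ hφ hφc => ?_
  set Φ : 𝓢(E, ℂ) := HasCompactSupport.toSchwartzMap (f := fun x => (φ x : ℂ))
    (hφc.comp_left (g := Complex.ofReal) (by simp)) (Complex.ofRealCLM.contDiff.comp hφ) with hΦ
  have e1 := congrArg (fun u => u Φ) (Lp.fourier_toTemperedDistribution_eq (h2.toLp g))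
  simp only [TemperedDistribution.fourier_apply, Lp.toTemperedDistribution_apply] at e1
  have e2 : ∫ x, 𝓕 Φ x • g x = ∫ x, Φ x • 𝓕 g x := by
    simpa using! VectorFourier.integral_bilin_fourierIntegral_eq_flip (.lsmul ℂ ℂ)
      (μ := volume) (ν := volume) (L := innerₗ E) (f := Φ) (g := g)
      Real.continuous_fourierChar continuous_inner Φ.integrable h1
  have e3 : ∫ x, 𝓕 Φ x • (h2.toLp g) x = ∫ x, 𝓕 Φ x • g x :=
    integral_congr_ae (h2.coeFn_toLp.mono fun x hx => by simp only [hx])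
  rw [e3, e2] at e1
  simpa [hΦ, HasCompactSupport.toSchwartzMap] using! e1.symm

theorem Lp.enorm_two_sq {α : Type*} [MeasurableSpace α] {μ : Measure α} (f : Lp ℂ 2 μ) :
    ‖f‖ₑ ^ 2 = ∫⁻ x, ‖f x‖ₑ ^ 2 ∂μ := by
  have := eLpNorm_nnreal_pow_eq_lintegral (f := f) (μ := μ) (p := 2) (by norm_num)
  rw [Lp.enorm_def]
  simpa using this

open scoped FourierTransform in
/-- Plancherel's theorem on `L¹ ∩ L²`, for the Fourier integral. -/
theorem lintegral_enorm_fourier_sq {E : Type*} [NormedAddCommGroup E] [InnerProductSpace ℝ E]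
    [FiniteDimensional ℝ E] [MeasurableSpace E] [BorelSpace E] {g : E → ℂ}
    (h1 : Integrable g) (h2 : MemLp g 2) :
    ∫⁻ w, ‖𝓕 g w‖ₑ ^ 2 = ∫⁻ t, ‖g t‖ₑ ^ 2 := by
  have a := Lp.enorm_two_sq (𝓕 (h2.toLp g))
  have b := Lp.enorm_two_sq (h2.toLp g)
  rw [lintegral_congr_ae (g := fun x => ‖𝓕 g x‖ₑ ^ 2)
    ((Lp.coeFn_fourier_toLp h1 h2).mono fun x hx => by simp only [hx])] at a
  rw [lintegral_congr_ae (g := fun x => ‖g x‖ₑ ^ 2)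
    (h2.coeFn_toLp.mono fun x hx => by simp only [hx])] at b
  rw [← a, ← b, ← enorm_norm (𝓕 _), Lp.norm_fourier_eq, enorm_norm]

/-! ### Trace identities and Parseval's identity -/

section Hilbert

variable {H : Type*} [NormedAddCommGroup H] [InnerProductSpace ℂ H] {ι : Type*}

theorem HilbertBasis.hasSum_sq_norm_inner (b : HilbertBasis ι ℂ H) (x : H) :
    HasSum (fun i => ‖⟪b i, x⟫_ℂ‖ ^ 2) (‖x‖ ^ 2) := by
  have h := b.hasSum_inner_mul_inner x x
  rw [inner_self_eq_norm_sq_to_K] at h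
  have h' : HasSum (fun i => ((‖⟪b i, x⟫_ℂ‖ ^ 2 : ℝ) : ℂ)) ((‖x‖ ^ 2 : ℝ) : ℂ) := by
    convert! h using 1
    · ext i
      rw [← inner_conj_symm x (b i), mul_comm, RCLike.mul_conj]
      push_cast; rfl
    · push_cast; rfl
  exact Complex.hasSum_ofReal.1 h'

theorem HilbertBasis.tsum_enorm_inner_sq (b : HilbertBasis ι ℂ H) (x : H) :
    ∑' i, ‖⟪b i, x⟫_ℂ‖ₑ ^ 2 = ‖x‖ₑ ^ 2 := by
  have h := b.hasSum_sq_norm_inner x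
  have := ENNReal.ofReal_tsum_of_nonneg (fun i => sq_nonneg _) h.summable
  rw [h.tsum_eq] at this
  simpa [ENNReal.ofReal_pow] using this.symm

theorem Orthonormal.tsum_enorm_inner_sq_le {h : ι → H} (hh : Orthonormal ℂ h) (x : H) :
    ∑' i, ‖⟪h i, x⟫_ℂ‖ₑ ^ 2 ≤ ‖x‖ₑ ^ 2 := by
  rw [ENNReal.tsum_eq_iSup_sum]
  refine iSup_le fun s => ?_
  have := ENNReal.ofReal_le_ofReal (hh.sum_inner_products_le x (s := s))
  rw [ENNReal.ofReal_sum_of_nonneg (fun i _ => sq_nonneg _)] at this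
  simpa [ENNReal.ofReal_pow] using this

variable [CompleteSpace H]

theorem ContinuousLinearMap.IsPositive.exists_sqrt {S : H →L[ℂ] H} (hS : S.IsPositive) :
    ∃ A : H →L[ℂ] H, A.adjoint = A ∧ A ∘L A = S := by
  rw [← ContinuousLinearMap.nonneg_iff_isPositive] at hS
  exact ⟨CFC.sqrt S, (IsSelfAdjoint.of_nonneg (CFC.sqrt_nonneg S)).adjoint_eq,
    CFC.sqrt_mul_sqrt_self S hS⟩

theorem opTrace_of_apply {A : H →L[ℂ] H} {x y : H} (hA : ∀ u, A u = ⟪y, u⟫_ℂ • x) :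
    opTrace A = ⟪y, x⟫_ℂ := by
  simp only [opTrace, hA, inner_smul_right]
  exact (onb H).tsum_inner_mul_inner y x

theorem inner_comp_self_apply {A : H →L[ℂ] H} (hA : A.adjoint = A) (x : H) :
    ⟪x, (A ∘L A) x⟫_ℂ = ((‖A x‖ ^ 2 : ℝ) : ℂ) := by
  rw [ContinuousLinearMap.comp_apply, ← ContinuousLinearMap.adjoint_inner_left, hA,
    inner_self_eq_norm_sq_to_K]
  push_cast; rfl

/-- A nonzero value of the trace of `A²` forces the defining series to converge, so `A` is
Hilbert–Schmidt. -/
theorem hasSum_sq_norm_of_opTrace {A : H →L[ℂ] H} (hA : A.adjoint = A)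
    (h : opTrace (A ∘L A) = 1) : HasSum (fun i => ‖A (onb H i)‖ ^ 2) 1 := by
  simp only [opTrace, inner_comp_self_apply hA] at h
  have hs : Summable fun i => ((‖A (onb H i)‖ ^ 2 : ℝ) : ℂ) := by
    by_contra hn
    rw [tsum_eq_zero_of_not_summable hn] at h
    exact zero_ne_one h
  have := hs.hasSum
  rw [h] at this
  exact Complex.hasSum_ofReal.1 (by simpa using! this)

theorem summable_uncurry_of_hasSum {α β : Type*} {a : α → β → ℝ} {s : α → ℝ}
    (h0 : ∀ j i, 0 ≤ a j i) (ha : ∀ j, HasSum (a j) (s j)) (hs : Summable s) :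
    Summable fun p : α × β => a p.1 p.2 := by
  refine (summable_prod_of_nonneg fun p => h0 p.1 p.2).2 ⟨fun j => (ha j).summable, ?_⟩
  simpa only [(ha _).tsum_eq] using hs

/-- Both sides are iterated sums of `⟪B⋆ A eⱼ, eᵢ⟫ ⟪eᵢ, A eⱼ⟫`, which is absolutely summable in
`(i, j)` because `A` is Hilbert–Schmidt. -/
theorem HilbertBasis.tsum_inner_comp_self_comp (e : HilbertBasis ι ℂ H) {A : H →L[ℂ] H}
    (hA : A.adjoint = A) (hs : Summable fun i => ‖A (e i)‖ ^ 2) (B : H →L[ℂ] H) :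
    ∑' i, ⟪e i, A (A (B (e i)))⟫_ℂ = ∑' j, ⟪A (e j), B (A (e j))⟫_ℂ := by
  have hAs : ∀ x y, ⟪A x, y⟫_ℂ = ⟪x, A y⟫_ℂ := fun x y => by
    rw [← ContinuousLinearMap.adjoint_inner_left, hA]
  set f : ι → ι → ℂ := fun j i =>
    ⟪B.adjoint (A (e j)), e i⟫_ℂ * ⟪e i, A (e j)⟫_ℂ with hf
  have h1 : ∀ i, ⟪e i, A (A (B (e i)))⟫_ℂ = ∑' j, f j i := fun i => by
    rw [← hAs, ← e.tsum_inner_mul_inner]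
    refine tsum_congr fun j => ?_
    simp only [hf]
    rw [ContinuousLinearMap.adjoint_inner_left, hAs, hAs, mul_comm]
  have h2 : ∀ j, ⟪A (e j), B (A (e j))⟫_ℂ = ∑' i, f j i := fun j => by
    simp only [hf]
    rw [e.tsum_inner_mul_inner, ContinuousLinearMap.adjoint_inner_left]
  rw [tsum_congr h1, tsum_congr h2]
  have hsum : Summable (Function.uncurry f) := by
    have hg : Summable fun p : ι × ι =>
        ‖⟪e p.2, B.adjoint (A (e p.1))⟫_ℂ‖ ^ 2 + ‖⟪e p.2, A (e p.1)⟫_ℂ‖ ^ 2 := by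
      refine summable_uncurry_of_hasSum (a := fun j i => ‖⟪e i, B.adjoint (A (e j))⟫_ℂ‖ ^ 2 +
        ‖⟪e i, A (e j)⟫_ℂ‖ ^ 2) (fun j i => add_nonneg (sq_nonneg _) (sq_nonneg _))
        (fun j => (e.hasSum_sq_norm_inner _).add (e.hasSum_sq_norm_inner _)) ?_
      refine Summable.add (Summable.of_nonneg_of_le (fun _ => sq_nonneg _) (fun j => ?_)
        (hs.mul_left (‖B.adjoint‖ ^ 2))) hs
      rw [← mul_pow]
      exact pow_le_pow_left₀ (norm_nonneg _) (B.adjoint.le_opNorm _) 2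
    refine Summable.of_norm_bounded hg ?_
    rintro ⟨j, i⟩
    simp only [Function.uncurry, hf, norm_mul]
    rw [norm_inner_symm]
    have := two_mul_le_add_sq ‖⟪e i, B.adjoint (A (e j))⟫_ℂ‖ ‖⟪e i, A (e j)⟫_ℂ‖
    have := mul_nonneg (norm_nonneg ⟪e i, B.adjoint (A (e j))⟫_ℂ) (norm_nonneg ⟪e i, A (e j)⟫_ℂ)
    linarith
  exact hsum.tsum_comm

/-- Cyclicity of the trace, in the form `tr (A² B) = tr (A B A)` for `A` self-adjoint and
Hilbert–Schmidt. -/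
theorem opTrace_comp_self_comp {A : H →L[ℂ] H} (hA : A.adjoint = A)
    (hs : Summable fun i => ‖A (onb H i)‖ ^ 2) (B : H →L[ℂ] H) :
    opTrace ((A ∘L A) ∘L B) = ∑' j, ⟪A (onb H j), B (A (onb H j))⟫_ℂ :=
  (onb H).tsum_inner_comp_self_comp hA hs B

end Hilbert

theorem Orthonormal.countable {H ι : Type*} [NormedAddCommGroup H] [InnerProductSpace ℂ H]
    [TopologicalSpace.SeparableSpace H] {h : ι → H} (hh : Orthonormal ℂ h) : Countable ι := by
  -- balls of radius `1 / 2` around the members of the family are disjoint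
  rw [← Set.countable_univ_iff]
  refine Set.PairwiseDisjoint.countable_of_isOpen (s := fun i => Metric.ball (h i) (1 / 2))
    (fun i _ j _ hij => ?_) (fun i _ => Metric.isOpen_ball)
    (fun i _ => ⟨h i, Metric.mem_ball_self (by norm_num)⟩)
  refine Metric.ball_disjoint_ball ?_
  have h2 : ‖h i - h j‖ ^ 2 = 2 := by
    rw [@norm_sub_sq ℂ, hh.2 hij, hh.1 i, hh.1 j]; norm_num
  rw [dist_eq_norm]
  nlinarith [norm_nonneg (h i - h j)]

/-! ### Existence of spectral representations of compact positive operators -/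

section CompactSpectral

variable {H : Type*} [NormedAddCommGroup H] [InnerProductSpace ℂ H] [CompleteSpace H]

/-- A self-adjoint Hilbert–Schmidt operator is compact. -/
theorem isCompactOperator_of_summable_sq_norm {ι : Type*} (b : HilbertBasis ι ℂ H) {B : H →L[ℂ] H}
    (hB : B.adjoint = B) (hs : Summable fun i => ‖B (b i)‖ ^ 2) : IsCompactOperator B := by
  classical
  -- `F s` is `B` followed by the projection onto the span of the basis vectors in `s`
  let F : Finset ι → H →L[ℂ] H := fun s => ∑ i ∈ s, InnerProductSpace.rankOne ℂ (b i) (B (b i))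
  have hF : ∀ s x j, ⟪b j, F s x⟫_ℂ = if j ∈ s then ⟪b j, B x⟫_ℂ else 0 := fun s x j => by
    simp only [F, sum_apply, InnerProductSpace.rankOne_apply, inner_sum,
      inner_smul_right, orthonormal_iff_ite.1 b.orthonormal]
    simp only [mul_ite, mul_one, mul_zero, Finset.sum_ite_eq]
    rw [← ContinuousLinearMap.adjoint_inner_left B, hB]
  have htail := tendsto_tsum_compl_atTop_zero fun i => ‖B (b i)‖ ^ 2
  have hbound : ∀ s, ‖F s - B‖ ≤ √(∑' i : {i // i ∉ s}, ‖B (b i)‖ ^ 2) := fun s => by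
    refine ContinuousLinearMap.opNorm_le_bound _ (Real.sqrt_nonneg _) fun x => ?_
    refine abs_le_of_sq_le_sq' ?_ (by positivity) |>.2
    rw [mul_pow, Real.sq_sqrt (tsum_nonneg fun _ => sq_nonneg _), ← tsum_mul_right]
    have hsum := b.hasSum_sq_norm_inner ((F s - B) x)
    have hval : ∀ i, ‖⟪b i, (F s - B) x⟫_ℂ‖ ^ 2 = if i ∈ s then 0 else ‖⟪b i, B x⟫_ℂ‖ ^ 2 := by
      intro i
      rw [sub_apply, inner_sub_right, hF]
      split_ifs <;> simp
    rw [← hsum.tsum_eq, ← hsum.summable.sum_add_tsum_subtype_compl s]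
    rw [Finset.sum_eq_zero fun i hi => by rw [hval, if_pos hi], zero_add]
    refine Summable.tsum_le_tsum (fun i => ?_) (hsum.summable.subtype _)
      ((hs.subtype _).mul_right _)
    rw [hval, if_neg i.2, ← ContinuousLinearMap.adjoint_inner_left, hB, ← mul_pow]
    exact pow_le_pow_left₀ (norm_nonneg _) (norm_inner_le_norm _ _) 2
  have hlim : Tendsto F atTop (𝓝 B) := by
    rw [tendsto_iff_norm_sub_tendsto_zero]
    refine squeeze_zero (fun _ => norm_nonneg _) hbound ?_
    simpa using htail.sqrt
  refine isCompactOperator_of_tendsto hlim (Eventually.of_forall fun s => ?_)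
  refine Submodule.sum_mem (compactOperator (RingHom.id ℂ) H H) fun i _ => ?_
  have h1 : IsCompactOperator (innerSL ℂ (B (b i))) := isCompactOperator_of_locallyCompactSpace_dom
    (innerSL ℂ (B (b i)))
  exact h1.clm_comp (ContinuousLinearMap.toSpanSingleton ℂ (b i))

theorem exists_eigenvector_norm [Nontrivial H] {T : H →L[ℂ] H} (hT : T.IsPositive)
    (hc : IsCompactOperator T) : ∃ v : H, v ≠ 0 ∧ T v = (‖T‖ : ℂ) • v := by
  rcases eq_or_ne T 0 with rfl | h0
  · obtain ⟨v, hv⟩ := exists_ne (0 : H)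
    exact ⟨v, hv, by simp⟩
  · have h1 := CStarAlgebra.norm_mem_spectrum_of_nonneg (a := T)
      ((ContinuousLinearMap.nonneg_iff_isPositive T).2 hT)
    have h2 : ((‖T‖ : ℝ) : ℂ) ∈ spectrum ℂ T := spectrum.algebraMap_mem ℂ h1
    have h3 := (hc.hasEigenvalue_iff_mem_spectrum (by simpa using h0)).2 h2
    obtain ⟨v, hv⟩ := h3.exists_hasEigenvector
    exact ⟨v, hv.2, hv.apply_eq_smul⟩

/-- A compact positive operator attains its norm on the orthogonal complement of a
finite-dimensional invariant subspace at an eigenvector. -/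
theorem exists_top_eigenvector {T : H →L[ℂ] H} (hT : T.IsPositive) (hc : IsCompactOperator T)
    (hinf : ¬ FiniteDimensional ℂ H) {U : Submodule ℂ H} (hUf : FiniteDimensional ℂ U)
    (hU : ∀ x ∈ U, T x ∈ U) :
    ∃ x ∈ Uᗮ, ‖x‖ = 1 ∧ ∃ l : ℝ, 0 ≤ l ∧ T x = (l : ℂ) • x ∧ ∀ y ∈ Uᗮ, ‖T y‖ ≤ l * ‖y‖ := by
  have hV : ∀ x ∈ Uᗮ, T x ∈ Uᗮ := fun x hx u hu => by
    rw [← hT.inner_left_eq_inner_right]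
    exact hx _ (hU u hu)
  have hne : Nontrivial Uᗮ := by
    rw [Submodule.nontrivial_iff_ne_bot]
    intro h
    rw [Submodule.orthogonal_eq_bot_iff] at h
    subst h
    exact hinf (Module.Finite.equiv (Submodule.topEquiv (R := ℂ) (M := H)))
  let T' : Uᗮ →L[ℂ] Uᗮ := T.restrict hV
  have hc' : IsCompactOperator T' := hc.restrict' hV
  have hp' : T'.IsPositive :=
    ContinuousLinearMap.isPositive_def.2 ⟨hT.isSymmetric.restrict_invariant hV,
      fun y => hT.re_inner_nonneg_left (y : H)⟩
  have hb : ∀ y ∈ Uᗮ, ‖T y‖ ≤ ‖T'‖ * ‖y‖ := fun y hy => T'.le_opNorm ⟨y, hy⟩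
  obtain ⟨v, hv0, hv⟩ := exists_eigenvector_norm hp' hc'
  have hv' : T v = (‖T'‖ : ℂ) • (v : H) := congrArg Subtype.val hv
  have hn : ‖(v : H)‖ ≠ 0 := by simpa using hv0
  refine ⟨((‖(v : H)‖⁻¹ : ℝ) : ℂ) • (v : H), Submodule.smul_mem _ _ v.2, ?_, ‖T'‖, T'.opNorm_nonneg,
    ?_, hb⟩
  · rw [norm_smul, Complex.norm_real, norm_inv, norm_norm, inv_mul_cancel₀ hn]
  · rw [map_smul, hv', smul_comm]

/-- The sequence is built greedily: `h n` is an eigenvector for the largest eigenvalue on the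
orthogonal complement of `h 0, …, h (n - 1)`. The hypothesis on orthonormal sequences makes the
eigenvalues summable, so the series converges absolutely in operator norm, and its partial sums
converge to `T` because the norm of `T` on the `n`-th complement is the `n`-th eigenvalue. -/
theorem exists_isSpectralRep {T : H →L[ℂ] H} (hT : T.IsPositive) (hc : IsCompactOperator T)
    (hinf : ¬ FiniteDimensional ℂ H)
    (hsum : ∀ h : ℕ → H, Orthonormal ℂ h → Summable fun k => RCLike.re ⟪h k, T (h k)⟫_ℂ) :
    ∃ lam h, IsSpectralRep T lam h := by
  choose! x hx hx1 l hl hTx hmax using fun (U : Submodule ℂ H)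
    (h : FiniteDimensional ℂ (U : Submodule ℂ H) ∧ ∀ x ∈ U, T x ∈ U) =>
    exists_top_eigenvector hT hc hinf h.1 h.2
  obtain ⟨U, hU0, hUs⟩ : ∃ U : ℕ → Submodule ℂ H, U 0 = ⊥ ∧
      ∀ n, U (n + 1) = U n ⊔ Submodule.span ℂ {x (U n)} :=
    ⟨fun n => n.rec ⊥ fun _ V => V ⊔ Submodule.span ℂ {x V}, rfl, fun _ => rfl⟩
  have hU : ∀ n : ℕ, Module.Finite ℂ (U n : Submodule ℂ H) ∧ ∀ y ∈ U n, T y ∈ U n := by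
    intro n
    induction n with
    | zero => rw [hU0]; exact ⟨inferInstance, by simp⟩
    | succ n ih =>
      have := ih.1
      rw [hUs]
      refine ⟨Submodule.finite_sup _ _, fun y hy => ?_⟩
      obtain ⟨u, hu, v, hv, rfl⟩ := Submodule.mem_sup.1 hy
      obtain ⟨c, rfl⟩ := Submodule.mem_span_singleton.1 hv
      rw [map_add, map_smul, hTx _ ih]
      exact Submodule.add_mem_sup (ih.2 u hu) (Submodule.smul_mem _ _ (Submodule.smul_mem _ _
        (Submodule.mem_span_singleton_self _)))
  set h : ℕ → H := fun n => x (U n) with hh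
  set lam : ℕ → ℝ := fun n => l (U n) with hlam
  have hmono : Monotone U := monotone_nat_of_le_succ fun n => by
    rw [hUs]; exact le_sup_left
  have hmem : ∀ n, h n ∈ U (n + 1) := fun n => by
    rw [hUs]
    exact Submodule.mem_sup_right (Submodule.mem_span_singleton_self _)
  have hperp : ∀ n, h n ∈ (U n)ᗮ := fun n => hx _ (hU n)
  have hTh : ∀ n, T (h n) = (lam n : ℂ) • h n := fun n => hTx _ (hU n)
  have hn1 : ∀ n, ‖h n‖ = 1 := fun n => hx1 _ (hU n)
  have hl0 : ∀ n, 0 ≤ lam n := fun n => hl _ (hU n)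
  have horth : Orthonormal ℂ h := by
    refine ⟨hn1, fun m n hmn => ?_⟩
    rcases lt_or_gt_of_ne hmn with hlt | hlt
    · exact hperp n _ (hmono hlt (hmem m))
    · exact inner_eq_zero_symm.1 (hperp m _ (hmono hlt (hmem n)))
  have hanti : Antitone lam := antitone_nat_of_succ_le fun n => by
    have := hmax _ (hU n) (h (n + 1)) (Submodule.orthogonal_le (hmono n.le_succ) (hperp (n + 1)))
    rw [hTh, norm_smul, hn1, Complex.norm_real, Real.norm_eq_abs, abs_of_nonneg (hl0 _)] at this
    simpa using this
  have hlsum : Summable lam := by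
    refine (hsum h horth).congr fun k => ?_
    rw [hTh, inner_smul_right, inner_self_eq_norm_sq_to_K, hn1]
    simp
  set P : ℕ → H →L[ℂ] H := fun k => (lam k : ℂ) • InnerProductSpace.rankOne ℂ (h k) (h k) with hP
  have hPs : Summable P := by
    refine Summable.of_norm_bounded hlsum fun k => ?_
    refine ContinuousLinearMap.opNorm_le_bound _ (hl0 k) fun y => ?_
    rw [hP, smul_apply, InnerProductSpace.rankOne_apply, norm_smul, norm_smul,
      hn1, mul_one, Complex.norm_real, Real.norm_eq_abs, abs_of_nonneg (hl0 _)]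
    gcongr
    · exact hl0 k
    · simpa [hn1] using norm_inner_le_norm (𝕜 := ℂ) (h k) y
  have hres : ∀ y n, y - ∑ k ∈ Finset.range n, ⟪h k, y⟫_ℂ • h k ∈ (U n)ᗮ := by
    intro y n
    induction n with
    | zero => simp [hU0]
    | succ n ih =>
      rw [Finset.sum_range_succ, ← sub_sub, hUs, ← Submodule.inf_orthogonal]
      refine ⟨Submodule.sub_mem _ ih (Submodule.smul_mem _ _ (hperp n)), ?_⟩
      rw [SetLike.mem_coe, Submodule.mem_orthogonal_singleton_iff_inner_right]
      have h0 : ∑ k ∈ Finset.range n, ⟪h k, y⟫_ℂ * ⟪h n, h k⟫_ℂ = 0 :=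
        Finset.sum_eq_zero fun k hk => by
          rw [horth.2 (Finset.mem_range.1 hk).ne', mul_zero]
      change ⟪h n, _⟫_ℂ = 0
      rw [inner_sub_right, inner_sub_right, inner_sum]
      simp only [inner_smul_right, h0]
      rw [inner_self_eq_norm_sq_to_K, hn1]
      simp
  have hlim : Tendsto (fun n => ∑ k ∈ Finset.range n, P k) atTop (𝓝 T) := by
    rw [tendsto_iff_norm_sub_tendsto_zero]
    refine squeeze_zero (fun _ => norm_nonneg _) (fun n => ?_) hlsum.tendsto_atTop_zero
    rw [norm_sub_rev]
    refine ContinuousLinearMap.opNorm_le_bound _ (hl0 n) fun y => ?_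
    set p := ∑ k ∈ Finset.range n, ⟪h k, y⟫_ℂ • h k with hp
    have e : (T - ∑ k ∈ Finset.range n, P k) y = T (y - p) := by
      simp only [sub_apply, sum_apply, hP, smul_apply,
        InnerProductSpace.rankOne_apply, map_sub, hp, map_sum, map_smul, hTh]
      congr 1
      exact Finset.sum_congr rfl fun k _ => smul_comm _ _ _
    have hpU : p ∈ U n := Submodule.sum_mem _ fun k hk =>
      Submodule.smul_mem _ _ (hmono (Finset.mem_range.1 hk) (hmem k))
    have hle : ‖y - p‖ ≤ ‖y‖ := by
      have h0 : ⟪p, y - p⟫_ℂ = 0 := hres y n p hpU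
      have := norm_add_sq_eq_norm_sq_add_norm_sq_of_inner_eq_zero p (y - p) h0
      rw [add_sub_cancel] at this
      nlinarith [norm_nonneg y, norm_nonneg (y - p), mul_self_nonneg ‖p‖]
    rw [e]
    exact (hmax _ (hU n) _ (hres y n)).trans (mul_le_mul_of_nonneg_left hle (hl0 n))
  refine ⟨lam, h, hanti, horth, ?_⟩
  rw [← tendsto_nhds_unique hPs.hasSum.tendsto_sum_nat hlim]
  exact hPs.hasSum

end CompactSpectral

/-! ### Translates of a ball -/

section Geometry

variable {E : Type*} [NormedAddCommGroup E] [NormedSpace ℝ E] [FiniteDimensional ℝ E]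
  [MeasurableSpace E] [BorelSpace E] {μ : Measure E} [μ.IsAddHaarMeasure]

theorem measure_notMem_add_mem_ball_le (hE : 0 < Module.finrank ℝ E) {R : ℝ} (hR : 0 < R) (w : E) :
    μ {z | z ∉ Metric.ball (0 : E) R ∧ z + w ∈ Metric.ball (0 : E) R} ≤
      ENNReal.ofReal (Module.finrank ℝ E * R ^ (Module.finrank ℝ E - 1) * ‖w‖) *
        μ (Metric.ball 0 1) := by
  have := Module.nontrivial_of_finrank_pos hE
  set n := Module.finrank ℝ E with hn
  have hn1 : (1 : ℝ) ≤ n := by exact_mod_cast hE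
  have hpow : R ^ n = R ^ (n - 1) * R := by rw [← pow_succ, Nat.sub_add_cancel hE]
  have hRn : 0 < R ^ (n - 1) := pow_pos hR _
  -- the set is contained in a translate of the spherical shell of thickness `‖w‖`
  have hsub : {z | z ∉ Metric.ball (0 : E) R ∧ z + w ∈ Metric.ball (0 : E) R} ⊆
      (fun z => z + w) ⁻¹' (Metric.ball 0 R \ Metric.ball 0 (R - ‖w‖)) := by
    rintro z ⟨hz, hzw⟩
    refine ⟨hzw, fun h => hz ?_⟩
    rw [mem_ball_zero_iff] at h ⊢
    have := norm_sub_le (z + w) w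
    rw [add_sub_cancel_right] at this
    linarith
  refine (measure_mono hsub).trans ?_
  rw [measure_preimage_add_right]
  rcases le_or_gt ‖w‖ R with hw | hw
  · rw [measure_sdiff (Metric.ball_subset_ball (by linarith [norm_nonneg w]))
      measurableSet_ball.nullMeasurableSet measure_ball_lt_top.ne,
      Measure.addHaar_ball μ _ hR.le, Measure.addHaar_ball μ _ (sub_nonneg.2 hw),
      ← ENNReal.sub_mul fun _ _ => measure_ball_lt_top.ne,
      ← ENNReal.ofReal_sub _ (pow_nonneg (sub_nonneg.2 hw) _)]
    gcongr
    have hb := one_add_mul_le_pow (a := -(‖w‖ / R))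
      (by have := (div_le_one hR).2 hw; linarith) n
    have h2 := mul_le_mul_of_nonneg_left hb (pow_pos hR n).le
    rw [← mul_pow, show R * (1 + -(‖w‖ / R)) = R - ‖w‖ by field_simp; ring] at h2
    have h3 : R ^ n * (1 + n * -(‖w‖ / R)) = R ^ n - n * R ^ (n - 1) * ‖w‖ := by
      rw [hpow]; field_simp; ring
    linarith
  · refine (measure_mono Set.sdiff_subset).trans ?_
    rw [Measure.addHaar_ball μ _ hR.le]
    gcongr
    rw [← hn, hpow]
    have := mul_le_mul_of_nonneg_left hw.le hRn.le
    have h4 : 0 ≤ R ^ (n - 1) * ‖w‖ := by positivity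
    nlinarith

/-- The measure of the part of a set that a translation moves in from outside is subadditive in the
translation. -/
theorem measure_notMem_add_mem_nsmul_le {E : Type*} [NormedAddCommGroup E] [MeasurableSpace E]
    [BorelSpace E] {μ : Measure E} [μ.IsAddRightInvariant] (B : Set E) (w : E) (n : ℕ) :
    μ {z | z ∉ B ∧ z + n • w ∈ B} ≤ n * μ {z | z ∉ B ∧ z + w ∈ B} := by
  induction n with
  | zero =>
    simp
  | succ n ih =>
    have hsub : {z | z ∉ B ∧ z + (n + 1) • w ∈ B} ⊆
        (fun z => z + w) ⁻¹' {z | z ∉ B ∧ z + n • w ∈ B} ∪ {z | z ∉ B ∧ z + w ∈ B} := by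
      rintro z ⟨hz, hzw⟩
      by_cases h : z + w ∈ B
      · exact Or.inr ⟨hz, h⟩
      · exact Or.inl ⟨h, by rwa [add_assoc, ← succ_nsmul']⟩
    refine (measure_mono hsub).trans ((measure_union_le _ _).trans ?_)
    rw [measure_preimage_add_right]
    push_cast
    rw [add_mul, one_mul]
    gcongr

/-- Apply `measure_notMem_add_mem_nsmul_le` to a multiple `n • w` at least as long as the diameter,
which moves the ball off itself. -/
theorem le_measure_notMem_add_mem_ball (hE : 0 < Module.finrank ℝ E) {R : ℝ} (hR1 : 1 ≤ R) (w : E) :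
    ENNReal.ofReal (R ^ (Module.finrank ℝ E - 1) / 3 * min ‖w‖ 1) * μ (Metric.ball 0 1) ≤
      μ {z | z ∉ Metric.ball (0 : E) R ∧ z + w ∈ Metric.ball (0 : E) R} := by
  have := Module.nontrivial_of_finrank_pos hE
  have hR : 0 < R := one_pos.trans_le hR1
  rcases eq_or_ne w 0 with rfl | hw0
  · simp
  have hw0' : 0 < ‖w‖ := norm_pos_iff.2 hw0
  set B := Metric.ball (0 : E) R
  -- the least multiple of `w` that is at least as long as the diameter
  set n := ⌈2 * R / ‖w‖⌉₊
  have hn0 : 0 < n := Nat.ceil_pos.2 (by positivity)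
  have hn1 : 2 * R ≤ n * ‖w‖ := by
    rw [← div_le_iff₀ hw0']; exact Nat.le_ceil _
  have hn2 : n * min ‖w‖ 1 ≤ 3 * R := by
    have := (Nat.ceil_lt_add_one (a := 2 * R / ‖w‖) (by positivity)).le
    have h1 : 2 * R / ‖w‖ * min ‖w‖ 1 ≤ 2 * R / ‖w‖ * ‖w‖ := by gcongr; exact min_le_left _ _
    rw [div_mul_cancel₀ _ hw0'.ne'] at h1
    calc n * min ‖w‖ 1 ≤ (2 * R / ‖w‖ + 1) * min ‖w‖ 1 := by gcongr
      _ ≤ 2 * R + 1 := by linarith [min_le_right ‖w‖ 1]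
      _ ≤ 3 * R := by linarith
  have hfull : μ B ≤ μ {z | z ∉ B ∧ z + n • w ∈ B} := by
    rw [← measure_preimage_add_right μ (n • w) B]
    refine measure_mono fun z hz => ⟨fun hzB => ?_, hz⟩
    rw [Set.mem_preimage, mem_ball_zero_iff] at hz
    rw [mem_ball_zero_iff] at hzB
    have h1 := norm_sub_le (z + n • w) z
    rw [← Nat.cast_smul_eq_nsmul ℝ] at hz
    rw [add_sub_cancel_left, ← Nat.cast_smul_eq_nsmul ℝ, norm_smul,
      Real.norm_natCast] at h1
    linarith
  have key := hfull.trans (measure_notMem_add_mem_nsmul_le B w n)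
  rw [Measure.addHaar_ball μ _ hR.le] at key
  refine (ENNReal.mul_le_mul_iff_right (a := (n : ℝ≥0∞)) (by exact_mod_cast hn0.ne')
    (ENNReal.natCast_ne_top n)).1 (le_trans ?_ key)
  rw [← mul_assoc, ← ENNReal.ofReal_natCast, ← ENNReal.ofReal_mul (by positivity)]
  gcongr
  rw [← Nat.sub_add_cancel hE, pow_succ, Nat.add_sub_cancel]
  have hRn : 0 < R ^ (Module.finrank ℝ E - 1) := pow_pos hR _
  nlinarith

end Geometry

/-! ### Decreasing sequences in the unit interval -/

section Sequences

/-- Bound `λ (1 - λ)` by `1 - λ` for the first `N` terms and by `λ` for the others. -/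
theorem tsum_mul_one_sub_le {lam : ℕ → ℝ} (h0 : ∀ k, 0 ≤ lam k) (h1 : ∀ k, lam k ≤ 1) {V : ℝ}
    (hV : HasSum lam V) (N : ℕ) :
    ∑' k, lam k * (1 - lam k) ≤ N + V - 2 * ∑ k ∈ Finset.range N, lam k := by
  have hs : Summable fun k => lam k * (1 - lam k) := Summable.of_nonneg_of_le
    (fun k => mul_nonneg (h0 k) (by linarith [h1 k])) (fun k => by nlinarith [h0 k]) hV.summable
  rw [← hs.sum_add_tsum_nat_add N]
  have e1 := hV.summable.sum_add_tsum_nat_add N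
  rw [hV.tsum_eq] at e1
  have e2 : ∑' k, lam (k + N) * (1 - lam (k + N)) ≤ ∑' k, lam (k + N) :=
    Summable.tsum_le_tsum (fun k => by nlinarith [h0 (k + N)])
      ((summable_nat_add_iff N).2 hs) ((summable_nat_add_iff N).2 hV.summable)
  have e3 : ∑ k ∈ Finset.range N, lam k * (1 - lam k) ≤ ∑ k ∈ Finset.range N, (1 - lam k) :=
    Finset.sum_le_sum fun k _ => by nlinarith [h0 k, h1 k]
  simp only [Finset.sum_sub_distrib, Finset.sum_const, Finset.card_range, nsmul_eq_mul, mul_one]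
    at e3
  linarith

theorem le_two_mul_tsum_mul_one_sub {lam : ℕ → ℝ} (ha : Antitone lam) (h0 : ∀ k, 0 ≤ lam k)
    (h1 : ∀ k, lam k ≤ 1) {V : ℝ} (hV : HasSum lam V) {N : ℕ} (hN : V ≤ N) :
    N + V - 2 * ∑ k ∈ Finset.range N, lam k ≤ N - V + 2 * ∑' k, lam k * (1 - lam k) := by
  have hs : Summable fun k => lam k * (1 - lam k) := Summable.of_nonneg_of_le
    (fun k => mul_nonneg (h0 k) (by linarith [h1 k])) (fun k => by nlinarith [h0 k]) hV.summable
  rw [← hs.sum_add_tsum_nat_add N]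
  have e1 := hV.summable.sum_add_tsum_nat_add N
  rw [hV.tsum_eq] at e1
  -- compare with the eigenvalue `lam N`, below for the first `N` terms and above for the others
  have e2 : (1 - lam N) * ∑' k, lam (k + N) ≤ ∑' k, lam (k + N) * (1 - lam (k + N)) := by
    rw [← tsum_mul_left]
    refine Summable.tsum_le_tsum (fun k => ?_)
      (((summable_nat_add_iff N).2 hV.summable).mul_left _) ((summable_nat_add_iff N).2 hs)
    have := ha (Nat.le_add_left N k)
    nlinarith [h0 (k + N)]
  have e3 : lam N * ∑ k ∈ Finset.range N, (1 - lam k) ≤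
      ∑ k ∈ Finset.range N, lam k * (1 - lam k) := by
    rw [Finset.mul_sum]
    refine Finset.sum_le_sum fun k hk => ?_
    have := ha (Finset.mem_range.1 hk).le
    nlinarith [h1 k]
  simp only [Finset.sum_sub_distrib, Finset.sum_const, Finset.card_range, nsmul_eq_mul, mul_one]
    at e3
  have e4 := mul_nonneg (h0 N) (sub_nonneg.2 hN)
  rw [← e1] at e4 ⊢
  linarith

end Sequences

section PhaseSpace

variable {d : ℕ}

/-! ### Moyal's identity -/

/-- The splitting of phase space into position and frequency preserves Lebesgue measure. -/
theorem Phase.measurePreserving_pos_freq :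
    MeasurePreserving (fun z : Phase d => (z.pos, z.freq)) volume (volume.prod volume) := by
  have h1 := PiLp.volume_preserving_ofLp (Fin d ⊕ Fin d)
  have h2 := volume_measurePreserving_sumPiEquivProdPi (fun _ : Fin d ⊕ Fin d => ℝ)
  have h3 := (PiLp.volume_preserving_toLp (Fin d)).prod (PiLp.volume_preserving_toLp (Fin d))
  exact h3.comp (h2.comp h1)

open scoped FourierTransform in
theorem inner_tfShift_eq_fourier (z : Phase d) (φ ψ : L2 d) :
    ⟪tfShift z φ, ψ⟫_ℂ =
      𝓕 (fun t => starRingEnd ℂ (φ (t - z.pos)) * ψ t) z.freq := by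
  rw [L2.inner_def, Real.fourier_eq]
  refine integral_congr_ae ?_
  filter_upwards [coeFn_modulation z.freq (translation z.pos φ), coeFn_translation z.pos φ]
    with t h1 h2
  simp only [tfShift, ContinuousLinearMap.comp_apply, RCLike.inner_apply, h1, h2, map_mul]
  rw [Circle.smul_def, Real.fourierChar_apply, tfChar, ← Complex.exp_conj, smul_eq_mul,
    real_inner_comm]
  simp only [map_mul, Complex.conj_ofReal, Complex.conj_I]
  have : (starRingEnd ℂ) 2 = 2 := Complex.conj_ofNat 2
  rw [this]
  push_cast
  ring_nf

/-- The point `(x, ω)` of phase space. -/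
def Phase.mk (p : Pos d × Pos d) : Phase d := WithLp.toLp 2 (Sum.elim p.1 p.2)

theorem Phase.continuous_mk : Continuous (Phase.mk (d := d)) := by
  unfold Phase.mk
  refine (PiLp.continuous_toLp 2 _).comp (continuous_pi fun i => ?_)
  cases i <;> simp only [Sum.elim_inl, Sum.elim_inr] <;> fun_prop

theorem Phase.mk_pos_freq (z : Phase d) : Phase.mk (z.pos, z.freq) = z := by
  ext i; cases i <;> rfl

open scoped FourierTransform in
/-- Moyal's identity: for fixed position the short-time Fourier transform is a Fourier transform,
so it follows from Plancherel's theorem and Tonelli's theorem. -/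
theorem lintegral_enorm_inner_tfShift_sq (φ ψ : L2 d) :
    ∫⁻ z : Phase d, ‖⟪tfShift z φ, ψ⟫_ℂ‖ₑ ^ 2 = ‖φ‖ₑ ^ 2 * ‖ψ‖ₑ ^ 2 := by
  set g : Pos d → Pos d → ℂ := fun x t => starRingEnd ℂ (φ (t - x)) * ψ t with hg
  set F : Pos d × Pos d → ℝ≥0∞ := fun p => ‖⟪tfShift (Phase.mk p) φ, ψ⟫_ℂ‖ₑ ^ 2 with hF
  have hFm : Measurable F := by
    have : Continuous fun p : Pos d × Pos d => ⟪tfShift (Phase.mk p) φ, ψ⟫_ℂ :=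
      ((continuous_tfShift φ).comp Phase.continuous_mk).inner continuous_const
    exact this.measurable.enorm.pow_const 2
  have hFg : ∀ x w, F (x, w) = ‖𝓕 (g x) w‖ₑ ^ 2 := fun x w => by
    simp only [hF, inner_tfShift_eq_fourier]; rfl
  have hφm := (Lp.stronglyMeasurable φ).measurable
  have hψm := (Lp.stronglyMeasurable ψ).measurable
  have hgm : Measurable (Function.uncurry g) := by
    simp only [hg, Function.uncurry_def]
    have h1 : Measurable fun p : Pos d × Pos d => φ (p.2 - p.1) :=
      hφm.comp (measurable_snd.sub measurable_fst)
    exact (Complex.continuous_conj.measurable.comp h1).mul (hψm.comp measurable_snd)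
  have hg1 : ∀ x, Integrable (g x) := fun x => by
    have h := L2.integrable_inner (𝕜 := ℂ) (translation x φ) ψ
    refine h.congr ?_
    filter_upwards [coeFn_translation x φ] with t ht
    simp only [ht, RCLike.inner_apply, hg, mul_comm]
  have hsq : ∫⁻ x, ∫⁻ t, ‖g x t‖ₑ ^ 2 = ‖φ‖ₑ ^ 2 * ‖ψ‖ₑ ^ 2 := by
    rw [lintegral_lintegral_swap (f := fun x t => ‖g x t‖ₑ ^ 2)
      (hgm.enorm.pow_const 2).aemeasurable]
    have : ∀ t, ∫⁻ x, ‖g x t‖ₑ ^ 2 = ‖φ‖ₑ ^ 2 * ‖ψ t‖ₑ ^ 2 := fun t => by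
      simp only [hg, enorm_mul, mul_pow, RCLike.enorm_conj]
      have hm : Measurable fun x => φ (t - x) := hφm.comp (measurable_const.sub measurable_id)
      rw [lintegral_mul_const _ (hm.enorm.pow_const 2),
        lintegral_sub_left_eq_self (fun x => ‖φ x‖ₑ ^ 2) t, Lp.enorm_two_sq φ]
    simp only [this]
    rw [lintegral_const_mul _ (hψm.enorm.pow_const 2), Lp.enorm_two_sq ψ]
  have hg2 : ∀ᵐ x, MemLp (g x) 2 := by
    have hfin : ∫⁻ x, ∫⁻ t, ‖g x t‖ₑ ^ 2 ≠ ∞ := by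
      rw [hsq]; exact ENNReal.mul_ne_top (by simp) (by simp)
    filter_upwards [ae_lt_top (hgm.enorm.pow_const 2).lintegral_prod_right' hfin] with x hx
    refine ⟨(hg1 x).aestronglyMeasurable, ?_⟩
    have := eLpNorm_nnreal_pow_eq_lintegral (f := g x) (μ := volume) (p := 2) (by norm_num)
    by_contra h
    rw [not_lt, top_le_iff] at h
    simp only [ENNReal.coe_ofNat, h] at this
    simp [Function.uncurry] at hx this
    rw [← this] at hx
    exact lt_irrefl _ hx
  calc ∫⁻ z : Phase d, ‖⟪tfShift z φ, ψ⟫_ℂ‖ₑ ^ 2 = ∫⁻ z : Phase d, F (z.pos, z.freq) := by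
        simp only [hF, Phase.mk_pos_freq]
    _ = ∫⁻ p, F p ∂(volume.prod volume) := Phase.measurePreserving_pos_freq.lintegral_comp hFm
    _ = ∫⁻ x, ∫⁻ w, F (x, w) := lintegral_prod _ hFm.aemeasurable
    _ = ∫⁻ x, ∫⁻ t, ‖g x t‖ₑ ^ 2 := by
        refine lintegral_congr_ae (hg2.mono fun x hx => ?_)
        simp only [hFg]
        exact lintegral_enorm_fourier_sq (hg1 x) hx
    _ = _ := hsq

/-! ### The algebra of time-frequency shifts -/

theorem coeFn_parity (ψ : L2 d) : parity ψ =ᵐ[volume] fun t => ψ (-t) :=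
  Lp.coeFn_compMeasurePreserving ψ (Measure.measurePreserving_neg volume)

theorem parity_parity (ψ : L2 d) : parity (parity ψ) = ψ := by
  refine Lp.ext ?_
  have h2 := (Measure.measurePreserving_neg (volume : Measure (Pos d))).quasiMeasurePreserving.ae
    (coeFn_parity ψ)
  filter_upwards [coeFn_parity (parity ψ), h2] with t h1 h2
  rw [h1, h2, neg_neg]

theorem inner_parity_right (ψ φ : L2 d) : ⟪ψ, parity φ⟫_ℂ = ⟪parity ψ, φ⟫_ℂ := by
  have := (Lp.compMeasurePreservingₗᵢ ℂ (fun t : Pos d => -t)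
    (Measure.measurePreserving_neg volume) (E := ℂ) (p := 2)).inner_map_map (parity ψ) φ
  rw [← this]
  change ⟪ψ, parity φ⟫_ℂ = ⟪parity (parity ψ), parity φ⟫_ℂ
  rw [parity_parity]

theorem opCheck_opCheck (A : L2 d →L[ℂ] L2 d) : opCheck (opCheck A) = A := by
  ext1 ψ
  simp [opCheck, parity_parity]

theorem tfShift_apply_ae (z : Phase d) (ψ : L2 d) :
    tfShift z ψ =ᵐ[volume] fun t => tfChar z.freq t * ψ (t - z.pos) := by
  filter_upwards [coeFn_modulation z.freq (translation z.pos ψ), coeFn_translation z.pos ψ]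
    with t h1 h2
  rw [tfShift, ContinuousLinearMap.comp_apply, h1, h2]

theorem Phase.pos_add (z w : Phase d) : (z + w).pos = z.pos + w.pos := rfl
theorem Phase.freq_add (z w : Phase d) : (z + w).freq = z.freq + w.freq := rfl
theorem Phase.pos_neg (z : Phase d) : (-z).pos = -z.pos := rfl
theorem Phase.freq_neg (z : Phase d) : (-z).freq = -z.freq := rfl
theorem Phase.pos_zero : (0 : Phase d).pos = 0 := rfl
theorem Phase.freq_zero : (0 : Phase d).freq = 0 := rfl

theorem tfShift_zero (ψ : L2 d) : tfShift 0 ψ = ψ := by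
  refine Lp.ext ?_
  filter_upwards [tfShift_apply_ae 0 ψ] with t h
  rw [h, Phase.pos_zero, Phase.freq_zero]
  simp [tfChar]

theorem tfShift_tfShift (z w : Phase d) (ψ : L2 d) :
    tfShift z (tfShift w ψ) = tfChar w.freq (-z.pos) • tfShift (z + w) ψ := by
  refine Lp.ext ?_
  have ms := (measurePreserving_sub_right (volume : Measure (Pos d)) z.pos).quasiMeasurePreserving
  have h2 := ms.ae (tfShift_apply_ae w ψ)
  filter_upwards [tfShift_apply_ae z (tfShift w ψ), h2, tfShift_apply_ae (z + w) ψ,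
    Lp.coeFn_smul (tfChar w.freq (-z.pos)) (tfShift (z + w) ψ)] with t h1 h2 h3 h4
  rw [h1, h2, h4, Pi.smul_apply, h3, smul_eq_mul, Phase.pos_add, Phase.freq_add, sub_sub,
    ← mul_assoc, ← mul_assoc]
  congr 1
  simp only [tfChar, ← Complex.exp_add]
  congr 1
  simp only [inner_sub_right, inner_add_left, inner_neg_right]
  push_cast
  ring

theorem parity_tfShift_parity (z : Phase d) (ψ : L2 d) :
    parity (tfShift z (parity ψ)) = tfShift (-z) ψ := by
  refine Lp.ext ?_
  have mn := (Measure.measurePreserving_neg (volume : Measure (Pos d))).quasiMeasurePreserving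
  have ms := (measurePreserving_sub_right (volume : Measure (Pos d)) z.pos).quasiMeasurePreserving
  filter_upwards [coeFn_parity (tfShift z (parity ψ)), mn.ae (tfShift_apply_ae z (parity ψ)),
    mn.ae (ms.ae (coeFn_parity ψ)), tfShift_apply_ae (-z) ψ] with t h1 h2 h3 h4
  rw [h1, h2, h3, h4, Phase.pos_neg, Phase.freq_neg]
  rw [show -(-t - z.pos) = t - -z.pos by module]
  simp [tfChar]

theorem adjoint_tfShift_tfShift (z : Phase d) (ψ : L2 d) :
    (tfShift z).adjoint (tfShift z ψ) = ψ := by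
  have h : (tfShift z).adjoint ∘L tfShift z = 1 :=
    (ContinuousLinearMap.norm_map_iff_adjoint_comp_self _).1 (norm_tfShift z)
  exact DFunLike.congr_fun h ψ

theorem tfShift_neg (z : Phase d) (ψ : L2 d) :
    tfShift (-z) ψ = tfChar z.freq z.pos • (tfShift z).adjoint ψ := by
  have h := congrArg (tfShift z).adjoint (tfShift_tfShift z (-z) ψ)
  rw [adjoint_tfShift_tfShift, add_neg_cancel, tfShift_zero, map_smul, Phase.freq_neg] at h
  rw [h]
  simp [tfChar]

/-- Translation covariance of the time-frequency shifts, up to a unimodular factor. -/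
theorem exists_adjoint_tfShift_tfShift (z w : Phase d) :
    ∃ c : ℂ, ‖c‖ = 1 ∧ ∀ ψ : L2 d,
      (tfShift w).adjoint (tfShift z ψ) = c • (tfShift (w - z)).adjoint ψ := by
  refine ⟨tfChar (w - z).freq (-z.pos), norm_tfChar _ _, fun ψ => ?_⟩
  -- with `ψ = π(w - z) u`, the vector `π(z) ψ` is a multiple of `π(w) u`
  have h := tfShift_tfShift z (w - z) ((tfShift (w - z)).adjoint ψ)
  rw [tfShift_adjoint_apply, add_sub_cancel] at h
  rw [h, map_smul, adjoint_tfShift_tfShift]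

/-! ### Cohen's class distributions -/

/-- `Q_S(ψ)(z) = ⟨α_z(S) ψ, ψ⟩`. -/
theorem cohen_eq_inner (S : L2 d →L[ℂ] L2 d) (ψ : L2 d) (z : Phase d) :
    cohen S ψ z = ⟪ψ, opShift z S ψ⟫_ℂ := by
  -- the operator inside the trace has rank one
  have h := opTrace_of_apply
    (A := opCheck S ∘L opShift z (opCheck (InnerProductSpace.rankOne ℂ ψ ψ)))
    (x := opCheck S (tfShift z (parity ψ))) (y := tfShift z (parity ψ)) (fun u => by
      simp only [opShift, opCheck, ContinuousLinearMap.comp_apply,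
        InnerProductSpace.rankOne_apply, map_smul]
      rw [inner_parity_right, ContinuousLinearMap.adjoint_inner_right])
  rw [cohen, opConv, h, opCheck, ContinuousLinearMap.comp_apply, ContinuousLinearMap.comp_apply,
    inner_parity_right, parity_tfShift_parity, tfShift_neg, map_smul, inner_smul_left,
    inner_smul_right, ← mul_assoc, RCLike.conj_mul, norm_tfChar, opShift,
    ContinuousLinearMap.comp_apply, ContinuousLinearMap.comp_apply,
    ← ContinuousLinearMap.adjoint_inner_left (tfShift z)]
  simp

/-- The function `z ↦ ‖A π(z)⋆ ψ‖²` with values in `[0, ∞]`. For `A` self-adjoint it is Cohen's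
class distribution `Q_S(ψ)` of `S = A²`, in a form suited to Tonelli's theorem. -/
noncomputable def sqCohen (A : L2 d →L[ℂ] L2 d) (ψ : L2 d) (z : Phase d) : ℝ≥0∞ :=
  ‖A ((tfShift z).adjoint ψ)‖ₑ ^ 2

theorem inner_opShift_eq {A : L2 d →L[ℂ] L2 d} (hA : A.adjoint = A) (ψ : L2 d) (z : Phase d) :
    ⟪ψ, opShift z (A ∘L A) ψ⟫_ℂ = ((sqCohen A ψ z).toReal : ℂ) := by
  rw [opShift, ContinuousLinearMap.comp_apply, ← ContinuousLinearMap.adjoint_inner_left,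
    ContinuousLinearMap.comp_apply, inner_comp_self_apply hA, sqCohen]
  simp

theorem cohen_eq_sqCohen {A : L2 d →L[ℂ] L2 d} (hA : A.adjoint = A) (ψ : L2 d) (z : Phase d) :
    cohen (A ∘L A) ψ z = ((sqCohen A ψ z).toReal : ℂ) := by
  rw [cohen_eq_inner, inner_opShift_eq hA]

theorem sqCohen_le (A : L2 d →L[ℂ] L2 d) (ψ : L2 d) (z : Phase d) :
    sqCohen A ψ z ≤ ‖A‖ₑ ^ 2 * ‖ψ‖ₑ ^ 2 := by
  have h : ‖(tfShift z).adjoint ψ‖ₑ = ‖ψ‖ₑ := by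
    rw [← enorm_norm, ← norm_tfShift z ((tfShift z).adjoint ψ), tfShift_adjoint_apply, enorm_norm]
  rw [sqCohen, ← mul_pow, ← h]
  gcongr
  exact A.le_opENorm _

theorem sqCohen_ne_top (A : L2 d →L[ℂ] L2 d) (ψ : L2 d) (z : Phase d) : sqCohen A ψ z ≠ ∞ :=
  ENNReal.pow_ne_top (by simp)

theorem measurable_sqCohen (A : L2 d →L[ℂ] L2 d) (ψ : L2 d) : Measurable (sqCohen A ψ) :=
  (A.continuous.comp (continuous_tfShift_adjoint ψ)).enorm.measurable.pow_const 2

theorem sqCohen_eq_tsum {A : L2 d →L[ℂ] L2 d} (hA : A.adjoint = A) (ψ : L2 d) (z : Phase d) :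
    sqCohen A ψ z = ∑' j, ‖⟪tfShift z (A (onb (L2 d) j)), ψ⟫_ℂ‖ₑ ^ 2 := by
  rw [sqCohen, ← (onb (L2 d)).tsum_enorm_inner_sq]
  refine tsum_congr fun j => ?_
  rw [← ContinuousLinearMap.adjoint_inner_left, hA, ContinuousLinearMap.adjoint_inner_right]

theorem sqCohen_tfShift (A : L2 d →L[ℂ] L2 d) (ψ : L2 d) (z w : Phase d) :
    sqCohen A (tfShift z ψ) w = sqCohen A ψ (w - z) := by
  obtain ⟨c, hc, h⟩ := exists_adjoint_tfShift_tfShift (d := d) z w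
  have hc' : ‖c‖ₑ = 1 := by rw [← enorm_norm, hc]; simp
  rw [sqCohen, h, map_smul, enorm_smul, hc', one_mul, sqCohen]

instance countable_onbIndex : Countable (onbIndex (L2 d)) :=
  have : Fact ((2 : ℝ≥0∞) ≠ ∞) := ⟨by norm_num⟩
  (onb (L2 d)).orthonormal.countable

section SqCohen

variable {A : L2 d →L[ℂ] L2 d}

theorem tsum_enorm_sq_of_hasSum {ι E : Type*} [NormedAddCommGroup E] {v : ι → E} {a : ℝ}
    (h : HasSum (fun i => ‖v i‖ ^ 2) a) : ∑' i, ‖v i‖ₑ ^ 2 = ENNReal.ofReal a := by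
  have := ENNReal.ofReal_tsum_of_nonneg (fun i => sq_nonneg ‖v i‖) h.summable
  rw [h.tsum_eq] at this
  simpa [ENNReal.ofReal_pow] using this.symm

theorem measurable_enorm_inner_tfShift_sq (φ ψ : L2 d) :
    Measurable fun z : Phase d => ‖⟪tfShift z φ, ψ⟫_ℂ‖ₑ ^ 2 :=
  ((continuous_tfShift φ).inner continuous_const).enorm.measurable.pow_const 2

theorem lintegral_sqCohen (hA : A.adjoint = A) (h1 : ∑' j, ‖A (onb (L2 d) j)‖ₑ ^ 2 = 1)
    (ψ : L2 d) : ∫⁻ z, sqCohen A ψ z = ‖ψ‖ₑ ^ 2 := by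
  simp only [sqCohen_eq_tsum hA]
  rw [lintegral_tsum fun j => (measurable_enorm_inner_tfShift_sq _ ψ).aemeasurable]
  simp only [lintegral_enorm_inner_tfShift_sq]
  rw [ENNReal.tsum_mul_right, h1, one_mul]

/-- Bessel's inequality, together with `∑ⱼ ‖A eⱼ‖² = tr S = 1`. -/
theorem tsum_sqCohen_le_one (hA : A.adjoint = A) (h1 : ∑' j, ‖A (onb (L2 d) j)‖ₑ ^ 2 = 1)
    {ι : Type*} {h : ι → L2 d} (hh : Orthonormal ℂ h) (z : Phase d) :
    ∑' k, sqCohen A (h k) z ≤ 1 := by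
  simp only [sqCohen_eq_tsum hA]
  rw [ENNReal.tsum_comm, ← h1]
  refine ENNReal.tsum_le_tsum fun j => ?_
  have hn : ‖tfShift z (A (onb (L2 d) j))‖ₑ = ‖A (onb (L2 d) j)‖ₑ := by
    rw [← enorm_norm, norm_tfShift, enorm_norm]
  rw [← hn]
  refine le_of_eq_of_le (tsum_congr fun k => ?_) (hh.tsum_enorm_inner_sq_le _)
  rw [← enorm_norm, norm_inner_symm, enorm_norm]

/-- The function `S̃` of the operator `S = A²`, as a function with values in `[0, ∞]`. -/
noncomputable def sqTilde (A : L2 d →L[ℂ] L2 d) (w : Phase d) : ℝ≥0∞ :=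
  ∑' j, sqCohen A (A (onb (L2 d) j)) w

theorem measurable_sqTilde (A : L2 d →L[ℂ] L2 d) : Measurable (sqTilde A) :=
  Measurable.tsum fun _ => measurable_sqCohen A _

theorem lintegral_sqTilde (hA : A.adjoint = A) (h1 : ∑' j, ‖A (onb (L2 d) j)‖ₑ ^ 2 = 1) :
    ∫⁻ w, sqTilde A w = 1 := by
  simp only [sqTilde]
  rw [lintegral_tsum fun j => (measurable_sqCohen A _).aemeasurable]
  simp only [lintegral_sqCohen hA h1, h1]

theorem sqTilde_ne_top (h1 : ∑' j, ‖A (onb (L2 d) j)‖ₑ ^ 2 = 1) (w : Phase d) :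
    sqTilde A w ≠ ∞ := by
  have : sqTilde A w ≤ ‖A‖ₑ ^ 2 := by
    refine (ENNReal.tsum_le_tsum fun j => sqCohen_le A _ w).trans ?_
    rw [ENNReal.tsum_mul_left, h1, mul_one]
  exact ne_top_of_le_ne_top (by simp) this

theorem opTilde_eq_sqTilde (hA : A.adjoint = A) (hs : HasSum (fun j => ‖A (onb (L2 d) j)‖ ^ 2) 1)
    (w : Phase d) : opTilde (A ∘L A) w = ((sqTilde A w).toReal : ℂ) := by
  rw [opTilde, opConv, opCheck_opCheck, opTrace_comp_self_comp hA hs.summable, sqTilde,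
    ENNReal.tsum_toReal_eq fun j => sqCohen_ne_top A _ w, Complex.ofReal_tsum]
  exact tsum_congr fun j => inner_opShift_eq hA _ w

/-! ### Mixed-state localization operators -/

theorem integrable_charFn {Ω : Set (Phase d)} (hΩ : MeasurableSet Ω) (hv : volume Ω ≠ ∞) :
    Integrable (charFn Ω) :=
  (integrable_indicator_iff hΩ).2 (integrableOn_const hv)

/-- The quadratic form of the localization operator is `⟨(χ_Ω ⋆ S) ψ, ψ⟩ = ∫_Ω Q_S(ψ)`. -/
theorem inner_locOp (hA : A.adjoint = A) {Ω : Set (Phase d)} (hΩ : MeasurableSet Ω)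
    (hv : volume Ω ≠ ∞) (ψ : L2 d) :
    ⟪ψ, locOp Ω (A ∘L A) ψ⟫_ℂ = ((∫⁻ z in Ω, sqCohen A ψ z).toReal : ℂ) := by
  rw [locOp, inner_funConv (integrable_charFn hΩ hv)]
  have : ∀ z, charFn Ω z * ⟪ψ, opShift z (A ∘L A) ψ⟫_ℂ =
      Ω.indicator (fun z => ((sqCohen A ψ z).toReal : ℂ)) z := fun z => by
    rw [inner_opShift_eq hA, charFn]
    by_cases hz : z ∈ Ω <;> simp [hz]
  simp only [this]
  rw [integral_indicator hΩ, integral_complex_ofReal,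
    integral_toReal (measurable_sqCohen A ψ).aemeasurable
    (Eventually.of_forall fun z => (sqCohen_ne_top A ψ z).lt_top)]

section Spectral

variable {Ω : Set (Phase d)} {lam : ℕ → ℝ} {h : ℕ → L2 d}

theorem IsSpectralRep.hasSum_inner {H : Type*} [NormedAddCommGroup H] [InnerProductSpace ℂ H]
    [CompleteSpace H] {T : H →L[ℂ] H} {h : ℕ → H} (hT : IsSpectralRep T lam h) (ψ : H) :
    HasSum (fun k => ((lam k * ‖⟪h k, ψ⟫_ℂ‖ ^ 2 : ℝ) : ℂ)) ⟪ψ, T ψ⟫_ℂ := by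
  have h1 := (hT.hasSum.mapL (ContinuousLinearMap.apply ℂ H ψ)).mapL (innerSL ℂ ψ)
  convert! h1 using 1
  ext k
  simp only [ContinuousLinearMap.apply_apply, smul_apply,
    InnerProductSpace.rankOne_apply, innerSL_apply_apply, inner_smul_right]
  rw [← inner_conj_symm ψ (h k), RCLike.mul_conj]
  push_cast; rfl

theorem IsSpectralRep.inner_self {H : Type*} [NormedAddCommGroup H] [InnerProductSpace ℂ H]
    [CompleteSpace H] {T : H →L[ℂ] H} {h : ℕ → H} (hT : IsSpectralRep T lam h) (m : ℕ) :
    ⟪h m, T (h m)⟫_ℂ = lam m := by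
  rw [← (hT.hasSum_inner (h m)).tsum_eq, tsum_eq_single m]
  · simp [hT.orthonormal.1 m]
  · intro k hk
    simp [hT.orthonormal.2 hk]

theorem setLIntegral_sqCohen_le (hA : A.adjoint = A) (h1 : ∑' j, ‖A (onb (L2 d) j)‖ₑ ^ 2 = 1)
    (Ω : Set (Phase d)) (ψ : L2 d) : ∫⁻ z in Ω, sqCohen A ψ z ≤ ‖ψ‖ₑ ^ 2 :=
  (setLIntegral_le_lintegral _ _).trans (lintegral_sqCohen hA h1 ψ).le

theorem IsSpectralRep.eq_toReal (hA : A.adjoint = A) (hΩ : MeasurableSet Ω) (hv : volume Ω ≠ ∞)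
    (hT : IsSpectralRep (locOp Ω (A ∘L A)) lam h) (k : ℕ) :
    lam k = (∫⁻ z in Ω, sqCohen A (h k) z).toReal := by
  have := hT.inner_self k
  rw [inner_locOp hA hΩ hv] at this
  exact_mod_cast this.symm

theorem IsSpectralRep.lam_nonneg (hA : A.adjoint = A) (hΩ : MeasurableSet Ω) (hv : volume Ω ≠ ∞)
    (hT : IsSpectralRep (locOp Ω (A ∘L A)) lam h) (k : ℕ) : 0 ≤ lam k := by
  rw [hT.eq_toReal hA hΩ hv]
  exact ENNReal.toReal_nonneg

theorem setLIntegral_sqCohen_ne_top (hA : A.adjoint = A)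
    (h1 : ∑' j, ‖A (onb (L2 d) j)‖ₑ ^ 2 = 1) (Ω : Set (Phase d)) (ψ : L2 d) :
    ∫⁻ z in Ω, sqCohen A ψ z ≠ ∞ :=
  ne_top_of_le_ne_top (by simp) (setLIntegral_sqCohen_le hA h1 Ω ψ)

theorem IsSpectralRep.tsum_mul_enorm_inner_sq (hA : A.adjoint = A)
    (h1 : ∑' j, ‖A (onb (L2 d) j)‖ₑ ^ 2 = 1) (hΩ : MeasurableSet Ω) (hv : volume Ω ≠ ∞)
    (hT : IsSpectralRep (locOp Ω (A ∘L A)) lam h) (ψ : L2 d) :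
    ∑' k, ENNReal.ofReal (lam k) * ‖⟪ψ, h k⟫_ℂ‖ₑ ^ 2 = ∫⁻ z in Ω, sqCohen A ψ z := by
  have h0 := hT.lam_nonneg hA hΩ hv
  have hs := hT.hasSum_inner ψ
  rw [inner_locOp hA hΩ hv] at hs
  have hs' := Complex.hasSum_ofReal.1 hs
  have := ENNReal.ofReal_tsum_of_nonneg
    (fun k => mul_nonneg (h0 k) (sq_nonneg ‖⟪h k, ψ⟫_ℂ‖)) hs'.summable
  rw [hs'.tsum_eq, ENNReal.ofReal_toReal (setLIntegral_sqCohen_ne_top hA h1 Ω ψ)] at this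
  rw [this]
  refine tsum_congr fun k => ?_
  rw [ENNReal.ofReal_mul (h0 k), norm_inner_symm]
  simp [ENNReal.ofReal_pow]

/-- The identity `∑ₖ λₖ Q_S(hₖ) = χ_Ω ∗ S̃`, which expresses spectral sums over the localization
operator through the function `S̃`. -/
theorem IsSpectralRep.tsum_mul_sqCohen (hA : A.adjoint = A)
    (h1 : ∑' j, ‖A (onb (L2 d) j)‖ₑ ^ 2 = 1) (hΩ : MeasurableSet Ω) (hv : volume Ω ≠ ∞)
    (hT : IsSpectralRep (locOp Ω (A ∘L A)) lam h) (z : Phase d) :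
    ∑' k, ENNReal.ofReal (lam k) * sqCohen A (h k) z = ∫⁻ w in Ω, sqTilde A (w - z) := by
  simp only [sqCohen_eq_tsum hA, ← ENNReal.tsum_mul_left]
  rw [ENNReal.tsum_comm]
  simp only [hT.tsum_mul_enorm_inner_sq hA h1 hΩ hv, sqCohen_tfShift]
  have hm : ∀ j, Measurable fun w => sqCohen A (A (onb (L2 d) j)) (w - z) := fun j =>
    (measurable_sqCohen A _).comp (measurable_id.sub_const z)
  rw [← lintegral_tsum fun j => (hm j).aemeasurable]
  rfl

theorem IsSpectralRep.tsum_mul_setLIntegral (hA : A.adjoint = A)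
    (h1 : ∑' j, ‖A (onb (L2 d) j)‖ₑ ^ 2 = 1) (hΩ : MeasurableSet Ω) (hv : volume Ω ≠ ∞)
    (hT : IsSpectralRep (locOp Ω (A ∘L A)) lam h) (E : Set (Phase d)) :
    ∑' k, ENNReal.ofReal (lam k) * ∫⁻ z in E, sqCohen A (h k) z =
      ∫⁻ w, sqTilde A w * volume {z | z ∈ E ∧ z + w ∈ Ω} := by
  have hm := measurable_sqTilde A
  have e1 : ∀ z, ∫⁻ w in Ω, sqTilde A (w - z) =
      ∫⁻ w, sqTilde A w * Ω.indicator 1 (z + w) := fun z => by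
    rw [← lintegral_indicator hΩ, ← lintegral_add_left_eq_self _ z]
    refine lintegral_congr fun w => ?_
    by_cases hw : z + w ∈ Ω <;> simp [hw]
  have hi : Measurable fun p : Phase d × Phase d =>
      sqTilde A p.2 * Ω.indicator (1 : Phase d → ℝ≥0∞) (p.1 + p.2) :=
    (hm.comp measurable_snd).mul ((measurable_one.indicator hΩ).comp
      (measurable_fst.add measurable_snd))
  calc ∑' k, ENNReal.ofReal (lam k) * ∫⁻ z in E, sqCohen A (h k) z
      = ∫⁻ z in E, ∑' k, ENNReal.ofReal (lam k) * sqCohen A (h k) z := by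
        rw [lintegral_tsum fun k => ((measurable_sqCohen A _).const_mul _).aemeasurable]
        exact tsum_congr fun k => (lintegral_const_mul _ (measurable_sqCohen A _)).symm
    _ = ∫⁻ z in E, ∫⁻ w, sqTilde A w * Ω.indicator 1 (z + w) := by
        simp only [hT.tsum_mul_sqCohen hA h1 hΩ hv, e1]
    _ = ∫⁻ w, ∫⁻ z in E, sqTilde A w * Ω.indicator 1 (z + w) :=
        lintegral_lintegral_swap hi.aemeasurable
    _ = _ := by
        refine lintegral_congr fun w => ?_
        have hw : Measurable fun z : Phase d => z + w := measurable_id.add_const w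
        have : (fun z => Ω.indicator (1 : Phase d → ℝ≥0∞) (z + w)) =
          ((fun z => z + w) ⁻¹' Ω).indicator 1 := rfl
        rw [lintegral_const_mul _ (by rw [this]; exact measurable_one.indicator (hw hΩ)), this]
        congr 1
        rw [lintegral_indicator_one (hw hΩ), Measure.restrict_apply (hw hΩ)]
        congr 1
        ext z
        exact and_comm

theorem IsSpectralRep.tsum_ofReal (hA : A.adjoint = A)
    (h1 : ∑' j, ‖A (onb (L2 d) j)‖ₑ ^ 2 = 1) (hΩ : MeasurableSet Ω) (hv : volume Ω ≠ ∞)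
    (hT : IsSpectralRep (locOp Ω (A ∘L A)) lam h) :
    ∑' k, ENNReal.ofReal (lam k) = volume Ω := by
  have := hT.tsum_mul_setLIntegral hA h1 hΩ hv Set.univ
  have hn : ∀ k, ‖h k‖ₑ = 1 := fun k => by rw [← enorm_norm, hT.orthonormal.1]; simp
  simp only [Measure.restrict_univ, lintegral_sqCohen hA h1, hn, one_pow, mul_one,
    Set.mem_univ, true_and] at this
  rw [this]
  have e : ∀ w, volume {z | z + w ∈ Ω} = volume Ω := fun w =>
    measure_preimage_add_right volume w Ω
  simp only [e]
  rw [lintegral_mul_const _ (measurable_sqTilde A), lintegral_sqTilde hA h1, one_mul]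

theorem IsSpectralRep.hasSum_lam (hA : A.adjoint = A)
    (h1 : ∑' j, ‖A (onb (L2 d) j)‖ₑ ^ 2 = 1) (hΩ : MeasurableSet Ω) (hv : volume Ω ≠ ∞)
    (hT : IsSpectralRep (locOp Ω (A ∘L A)) lam h) : HasSum lam (volume.real Ω) := by
  have h0 := hT.lam_nonneg hA hΩ hv
  have := ENNReal.hasSum_toReal (f := fun k => ENNReal.ofReal (lam k))
    (by rwa [hT.tsum_ofReal hA h1 hΩ hv])
  rw [← ENNReal.tsum_toReal_eq fun k => ENNReal.ofReal_ne_top, hT.tsum_ofReal hA h1 hΩ hv] at this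
  simpa only [ENNReal.toReal_ofReal (h0 _)] using! this

theorem integrable_toReal_sqCohen (hA : A.adjoint = A) (h1 : ∑' j, ‖A (onb (L2 d) j)‖ₑ ^ 2 = 1)
    (ψ : L2 d) : Integrable fun z => (sqCohen A ψ z).toReal :=
  integrable_toReal_of_lintegral_ne_top (measurable_sqCohen A ψ).aemeasurable
    (by rw [lintegral_sqCohen hA h1]; simp)

theorem setIntegral_toReal_sqCohen (E : Set (Phase d)) (ψ : L2 d) :
    ∫ z in E, (sqCohen A ψ z).toReal = (∫⁻ z in E, sqCohen A ψ z).toReal :=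
  integral_toReal (measurable_sqCohen A ψ).aemeasurable
    (Eventually.of_forall fun z => (sqCohen_ne_top A ψ z).lt_top)

theorem integral_toReal_sqCohen (hA : A.adjoint = A) (h1 : ∑' j, ‖A (onb (L2 d) j)‖ₑ ^ 2 = 1)
    {ψ : L2 d} (hψ : ‖ψ‖ = 1) : ∫ z, (sqCohen A ψ z).toReal = 1 := by
  rw [← setIntegral_univ, setIntegral_toReal_sqCohen, Measure.restrict_univ,
    lintegral_sqCohen hA h1, ← enorm_norm, hψ]
  simp

/-- The mass of `Q_S(hₖ)` outside `Ω` is `1 - λₖ`, so this is the identity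
`∑ₖ λₖ (1 - λₖ) = tr T - tr T² = ∫_{Ωᶜ} χ_Ω ∗ S̃` for `T = χ_Ω ⋆ S`. -/
theorem IsSpectralRep.tsum_ofReal_mul_one_sub (hA : A.adjoint = A)
    (h1 : ∑' j, ‖A (onb (L2 d) j)‖ₑ ^ 2 = 1) (hΩ : MeasurableSet Ω) (hv : volume Ω ≠ ∞)
    (hT : IsSpectralRep (locOp Ω (A ∘L A)) lam h) :
    ∑' k, ENNReal.ofReal (lam k * (1 - lam k)) =
      ∫⁻ w, sqTilde A w * volume {z | z ∉ Ω ∧ z + w ∈ Ω} := by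
  have h0 := hT.lam_nonneg hA hΩ hv
  have := hT.tsum_mul_setLIntegral hA h1 hΩ hv Ωᶜ
  rw [show (∫⁻ w, sqTilde A w * volume {z | z ∉ Ω ∧ z + w ∈ Ω}) =
    ∫⁻ w, sqTilde A w * volume {z | z ∈ Ωᶜ ∧ z + w ∈ Ω} from rfl, ← this]
  refine tsum_congr fun k => ?_
  rw [ENNReal.ofReal_mul (h0 k)]
  congr 1
  rw [← ENNReal.ofReal_toReal (setLIntegral_sqCohen_ne_top hA h1 Ωᶜ (h k)),
    ← setIntegral_toReal_sqCohen, setIntegral_compl hΩ (integrable_toReal_sqCohen hA h1 _),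
    integral_toReal_sqCohen hA h1 (hT.orthonormal.1 k), setIntegral_toReal_sqCohen,
    ← hT.eq_toReal hA hΩ hv]

theorem norm_ofReal_sub_indicator {α : Type*} (s : Set α) {r : ℝ} (h0 : 0 ≤ r) (h1 : r ≤ 1)
    (x : α) : ‖(r : ℂ) - s.indicator 1 x‖ =
      r + s.indicator 1 x - 2 * s.indicator (fun _ => r) x := by
  by_cases hx : x ∈ s
  · simp only [hx, Set.indicator_of_mem, Pi.one_apply]
    rw [show (r : ℂ) - 1 = ((r - 1 : ℝ) : ℂ) by push_cast; rfl, Complex.norm_real,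
      Real.norm_eq_abs, abs_of_nonpos (by linarith)]
    ring
  · simp [hx, abs_of_nonneg h0]

theorem integrable_accCohen_sub (hA : A.adjoint = A) (h1 : ∑' j, ‖A (onb (L2 d) j)‖ₑ ^ 2 = 1)
    (hΩ : MeasurableSet Ω) (hv : volume Ω ≠ ∞) (h : ℕ → L2 d) :
    Integrable fun z => accCohen (A ∘L A) Ω h z - charFn Ω z := by
  refine Integrable.sub ?_ (integrable_charFn hΩ hv)
  unfold accCohen
  simp only [cohen_eq_sqCohen hA]
  exact integrable_finsetSum _ fun k _ => (integrable_toReal_sqCohen hA h1 _).ofReal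

/-- Since `0 ≤ ρ ≤ 1`, the integrand is `ρ + χ_Ω - 2 χ_Ω ρ`. -/
theorem IsSpectralRep.integral_norm_accCohen_sub (hA : A.adjoint = A)
    (h1 : ∑' j, ‖A (onb (L2 d) j)‖ₑ ^ 2 = 1) (hΩ : MeasurableSet Ω) (hv : volume Ω ≠ ∞)
    (hT : IsSpectralRep (locOp Ω (A ∘L A)) lam h) :
    ∫ z, ‖accCohen (A ∘L A) Ω h z - charFn Ω z‖ =
      ⌈volume.real Ω⌉₊ + volume.real Ω - 2 * ∑ k ∈ Finset.range ⌈volume.real Ω⌉₊, lam k := by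
  unfold accCohen
  generalize ⌈volume.real Ω⌉₊ = N
  -- `ρ` is the accumulated distribution as a real function
  set ρ : Phase d → ℝ := fun z => ∑ k ∈ Finset.range N, (sqCohen A (h k) z).toReal with hρ
  have hρ0 : ∀ z, 0 ≤ ρ z := fun z => Finset.sum_nonneg fun k _ => ENNReal.toReal_nonneg
  have hρ1 : ∀ z, ρ z ≤ 1 := fun z => by
    have := (ENNReal.sum_le_tsum (Finset.range N)).trans
      (tsum_sqCohen_le_one hA h1 hT.orthonormal z)
    change ∑ k ∈ Finset.range N, (sqCohen A (h k) z).toReal ≤ 1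
    rw [← ENNReal.toReal_sum fun k _ => sqCohen_ne_top A _ z]
    exact ENNReal.toReal_le_of_le_ofReal zero_le_one (by simpa using this)
  have hρi : Integrable ρ := integrable_finsetSum _ fun k _ => integrable_toReal_sqCohen hA h1 _
  have e : ∀ z, ‖∑ k ∈ Finset.range N, cohen (A ∘L A) (h k) z - charFn Ω z‖ =
      ρ z + Ω.indicator 1 z - 2 * Ω.indicator ρ z := fun z => by
    have : ∑ k ∈ Finset.range N, cohen (A ∘L A) (h k) z = (ρ z : ℂ) := by
      simp only [cohen_eq_sqCohen hA, hρ, Complex.ofReal_sum]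
    rw [this, charFn, norm_ofReal_sub_indicator Ω (hρ0 z) (hρ1 z)]
    by_cases hz : z ∈ Ω <;> simp only [hz, Set.indicator_of_mem, Set.indicator_of_notMem,
      not_false_eq_true]
  have hχ : Integrable (Ω.indicator (1 : Phase d → ℝ)) :=
    (integrable_indicator_iff hΩ).2 (integrableOn_const hv)
  simp only [e]
  rw [integral_sub (f := fun z => ρ z + Ω.indicator 1 z) (hρi.add hχ)
      ((hρi.indicator hΩ).const_mul 2),
    integral_add hρi hχ,
    integral_const_mul, integral_indicator_one hΩ, integral_indicator hΩ, hρ,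
    integral_finsetSum _ fun k _ => integrable_toReal_sqCohen hA h1 _,
    integral_finsetSum _ fun k _ => (integrable_toReal_sqCohen hA h1 _).integrableOn]
  simp only [integral_toReal_sqCohen hA h1 (hT.orthonormal.1 _), setIntegral_toReal_sqCohen,
    ← hT.eq_toReal hA hΩ hv]
  simp

end Spectral
end SqCohen

theorem Phase.finrank_eq : Module.finrank ℝ (Phase d) = 2 * d := by
  simp [two_mul]

section Existence

variable {A : L2 d →L[ℂ] L2 d}

/-- On a finite-dimensional space, integrating Parseval's identity for the time-frequency shifts of
`φ` would contradict Moyal's identity. -/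
theorem not_finiteDimensional_L2 (hd : 1 ≤ d) {φ : L2 d} (hφ : φ ≠ 0) :
    ¬ FiniteDimensional ℂ (L2 d) := by
  intro hf
  have hfin : Finite (onbIndex (L2 d)) :=
    (onb (L2 d)).orthonormal.linearIndependent.finite
  have := Fintype.ofFinite (onbIndex (L2 d))
  have hlt : ∑' i, ∫⁻ z : Phase d, ‖⟪tfShift z φ, onb (L2 d) i⟫_ℂ‖ₑ ^ 2 ≠ ∞ := by
    simp only [lintegral_enorm_inner_tfShift_sq, tsum_fintype]
    exact ENNReal.sum_ne_top.2 fun i _ => ENNReal.mul_ne_top (by simp) (by simp)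
  rw [← lintegral_tsum fun i => (measurable_enorm_inner_tfShift_sq _ _).aemeasurable] at hlt
  have hsum : ∀ z : Phase d, ∑' i, ‖⟪tfShift z φ, onb (L2 d) i⟫_ℂ‖ₑ ^ 2 = ‖φ‖ₑ ^ 2 := fun z => by
    have hn : ‖tfShift z φ‖ₑ = ‖φ‖ₑ := by rw [← enorm_norm, norm_tfShift, enorm_norm]
    rw [← hn, ← (onb (L2 d)).tsum_enorm_inner_sq]
    refine tsum_congr fun k => ?_
    rw [← enorm_norm, norm_inner_symm, enorm_norm]
  have : Nontrivial (Phase d) :=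
    Module.nontrivial_of_finrank_pos (R := ℝ) (by rw [Phase.finrank_eq]; omega)
  have : NoncompactSpace (Phase d) := NormedSpace.noncompactSpace ℝ (Phase d)
  simp only [hsum, lintegral_const, measure_univ_of_isAddLeftInvariant] at hlt
  exact hlt (ENNReal.mul_top (by simpa using hφ))

theorem isPositive_locOp (hA : A.adjoint = A) {Ω : Set (Phase d)} (hΩ : MeasurableSet Ω)
    (hv : volume Ω ≠ ∞) : (locOp Ω (A ∘L A)).IsPositive := by
  rw [ContinuousLinearMap.isPositive_iff_complex]
  intro ψ
  have := inner_locOp hA hΩ hv ψ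
  rw [← inner_conj_symm, this]
  simp

/-- The localization operator has finite trace along every orthonormal family. -/
theorem summable_setLIntegral_sqCohen (hA : A.adjoint = A)
    (h1 : ∑' j, ‖A (onb (L2 d) j)‖ₑ ^ 2 = 1) {Ω : Set (Phase d)} (hv : volume Ω ≠ ∞)
    {ι : Type*} {h : ι → L2 d} (hh : Orthonormal ℂ h) :
    Summable fun k => (∫⁻ z in Ω, sqCohen A (h k) z).toReal := by
  have : Fact ((2 : ℝ≥0∞) ≠ ∞) := ⟨by norm_num⟩
  have := hh.countable
  refine ENNReal.summable_toReal ?_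
  rw [← lintegral_tsum fun k => (measurable_sqCohen A _).aemeasurable]
  have : ∫⁻ z in Ω, ∑' k, sqCohen A (h k) z ≤ ∫⁻ z in Ω, 1 :=
    lintegral_mono fun z => tsum_sqCohen_le_one hA h1 hh z
  rw [setLIntegral_one] at this
  exact ne_top_of_le_ne_top hv this

theorem exists_isSpectralRep_locOp (hd : 1 ≤ d) (hA : A.adjoint = A)
    (h1 : ∑' j, ‖A (onb (L2 d) j)‖ₑ ^ 2 = 1) {Ω : Set (Phase d)} (hΩ : MeasurableSet Ω)
    (hv : volume Ω ≠ ∞) : ∃ lam h, IsSpectralRep (locOp Ω (A ∘L A)) lam h := by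
  have hT := isPositive_locOp hA hΩ hv
  obtain ⟨B, hB, hBT⟩ := hT.exists_sqrt
  have hBc : IsCompactOperator B := by
    refine isCompactOperator_of_summable_sq_norm (onb (L2 d)) hB
      ((summable_setLIntegral_sqCohen hA h1 hv (onb (L2 d)).orthonormal).congr fun i => ?_)
    have := inner_comp_self_apply hB (onb (L2 d) i)
    rw [hBT, inner_locOp hA hΩ hv] at this
    exact_mod_cast this
  have hc : IsCompactOperator (locOp Ω (A ∘L A)) := by
    rw [← hBT]
    exact hBc.clm_comp B
  obtain ⟨j, hj⟩ : ∃ j, A (onb (L2 d) j) ≠ 0 := by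
    by_contra! h
    simp [h] at h1
  refine exists_isSpectralRep hT hc (not_finiteDimensional_L2 hd hj) fun h hh => ?_
  refine (summable_setLIntegral_sqCohen hA h1 hv hh).congr fun k => ?_
  rw [inner_locOp hA hΩ hv]
  simp

end Existence

/-! ### Estimates for the ball -/

theorem IsSpectralRep.tsum_mul_one_sub {A : L2 d →L[ℂ] L2 d} (hA : A.adjoint = A)
    (h1 : ∑' j, ‖A (onb (L2 d) j)‖ₑ ^ 2 = 1) {Ω : Set (Phase d)} (hΩ : MeasurableSet Ω)
    (hv : volume Ω ≠ ∞) {lam : ℕ → ℝ} {h : ℕ → L2 d}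
    (hT : IsSpectralRep (locOp Ω (A ∘L A)) lam h) :
    (∀ k, 0 ≤ lam k) ∧ (∀ k, lam k ≤ 1) ∧ ENNReal.ofReal (∑' k, lam k * (1 - lam k)) =
      ∫⁻ w, sqTilde A w * volume {z | z ∉ Ω ∧ z + w ∈ Ω} := by
  have h0 := hT.lam_nonneg hA hΩ hv
  have hle : ∀ k, lam k ≤ 1 := fun k => by
    rw [hT.eq_toReal hA hΩ hv]
    refine ENNReal.toReal_le_of_le_ofReal zero_le_one
      ((setLIntegral_sqCohen_le hA h1 Ω (h k)).trans_eq ?_)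
    rw [← enorm_norm, hT.orthonormal.1]
    simp
  refine ⟨h0, hle, ?_⟩
  rw [← hT.tsum_ofReal_mul_one_sub hA h1 hΩ hv]
  refine ENNReal.ofReal_tsum_of_nonneg (fun k => mul_nonneg (h0 k) (by linarith [hle k])) ?_
  exact Summable.of_nonneg_of_le (fun k => mul_nonneg (h0 k) (by linarith [hle k]))
    (fun k => by nlinarith [h0 k]) (hT.hasSum_lam hA h1 hΩ hv).summable

section Ball

variable {A : L2 d →L[ℂ] L2 d}

theorem lintegral_sqTilde_mul_min_norm_ne_zero (hd : 1 ≤ d) (hA : A.adjoint = A)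
    (h1 : ∑' j, ‖A (onb (L2 d) j)‖ₑ ^ 2 = 1) :
    ∫⁻ w, sqTilde A w * ENNReal.ofReal (min ‖w‖ 1) ≠ 0 := by
  have : Nontrivial (Phase d) :=
    Module.nontrivial_of_finrank_pos (R := ℝ) (by rw [Phase.finrank_eq]; omega)
  intro h
  have hm : Measurable fun w : Phase d => sqTilde A w * ENNReal.ofReal (min ‖w‖ 1) :=
    (measurable_sqTilde A).mul (by fun_prop)
  rw [lintegral_eq_zero_iff hm] at h
  have h0 : sqTilde A =ᵐ[volume] 0 := by
    filter_upwards [h, Measure.ae_ne volume (0 : Phase d)] with w hw hw0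
    have hpos : 0 < min ‖w‖ 1 := lt_min (norm_pos_iff.2 hw0) one_pos
    exact (mul_eq_zero.1 hw).resolve_right (ENNReal.ofReal_pos.2 hpos).ne'
  have := lintegral_sqTilde hA h1
  rw [lintegral_congr_ae h0] at this
  simp at this

theorem lintegral_sqTilde_mul_enorm_ne_top (hA : A.adjoint = A)
    (hs : HasSum (fun j => ‖A (onb (L2 d) j)‖ ^ 2) 1)
    (hi : Integrable fun z : Phase d => opTilde (A ∘L A) z * (‖z‖ : ℂ)) :
    ∫⁻ w, sqTilde A w * ‖w‖ₑ ≠ ∞ := by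
  have h1 := tsum_enorm_sq_of_hasSum hs
  rw [ENNReal.ofReal_one] at h1
  refine ne_of_eq_of_ne (lintegral_congr fun w => ?_) hi.hasFiniteIntegral.ne
  dsimp only
  rw [opTilde_eq_sqTilde hA hs, enorm_mul, ← enorm_norm ((sqTilde A w).toReal : ℂ),
    Complex.norm_real, Real.norm_of_nonneg ENNReal.toReal_nonneg,
    Real.enorm_of_nonneg ENNReal.toReal_nonneg, ENNReal.ofReal_toReal (sqTilde_ne_top h1 w)]
  congr 1
  rw [← enorm_norm (‖w‖ : ℂ)]
  simp

end Ball

end PhaseSpace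

theorem mainTheorem3 (d : ℕ) (hd : 1 ≤ d) (S : L2 d →L[ℂ] L2 d) (hS : S ∈ MopStar d) :
    ∃ C₁ C₂ : ℝ, 0 < C₁ ∧ 0 < C₂ ∧ ∀ R : ℝ, 1 < R →
      (∃ lam h, IsSpectralRep (locOp (Metric.ball (0 : Phase d) R) S) lam h) ∧
      ∀ (lam : ℕ → ℝ) (h : ℕ → L2 d),
        IsSpectralRep (locOp (Metric.ball (0 : Phase d) R) S) lam h →
          Integrable (fun z : Phase d => accCohen S (Metric.ball (0 : Phase d) R) h z -
            charFn (Metric.ball (0 : Phase d) R) z) ∧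
          C₁ * R ^ (2 * d - 1) ≤ ∫ z : Phase d, ‖accCohen S (Metric.ball (0 : Phase d) R) h z -
            charFn (Metric.ball (0 : Phase d) R) z‖ ∧
          ∫ z : Phase d, ‖accCohen S (Metric.ball (0 : Phase d) R) h z -
            charFn (Metric.ball (0 : Phase d) R) z‖ ≤ C₂ * R ^ (2 * d - 1) := by
  obtain ⟨-, hpos, htr, hint⟩ := hS
  obtain ⟨A, hA, rfl⟩ := hpos.exists_sqrt
  have hs := hasSum_sq_norm_of_opTrace hA htr
  have h1 := tsum_enorm_sq_of_hasSum hs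
  rw [ENNReal.ofReal_one] at h1
  have hfr : 0 < Module.finrank ℝ (Phase d) := by rw [Phase.finrank_eq]; omega
  set b : ℝ≥0∞ := volume (Metric.ball (0 : Phase d) 1)
  have hb0 : b ≠ 0 := (Metric.measure_ball_pos _ _ one_pos).ne'
  have hbt : b ≠ ∞ := measure_ball_lt_top.ne
  set m : ℝ≥0∞ := ∫⁻ w, sqTilde A w * ENNReal.ofReal (min ‖w‖ 1)
  set M : ℝ≥0∞ := ∫⁻ w, sqTilde A w * ‖w‖ₑ
  have hm0 : m ≠ 0 := lintegral_sqTilde_mul_min_norm_ne_zero hd hA h1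
  have hMt : M ≠ ∞ := lintegral_sqTilde_mul_enorm_ne_top hA hs hint
  have hmt : m ≠ ∞ := ne_top_of_le_ne_top hMt (lintegral_mono fun w => by
    dsimp only
    gcongr
    rw [← ofReal_norm]
    exact ENNReal.ofReal_le_ofReal (min_le_left _ _))
  have hbm : 0 < (b * m).toReal := ENNReal.toReal_pos (mul_ne_zero hb0 hm0)
    (ENNReal.mul_ne_top hbt hmt)
  -- the bound `⌈|B|⌉ - |B| ≤ 1` accounts for the summand `1`, since `1 ≤ R ^ (2 * d - 1)`
  refine ⟨(b * m).toReal / 3, 1 + 2 * (2 * d * (b * M).toReal), by positivity, by positivity,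
    fun R hR => ?_⟩
  have hR0 : 0 < R := one_pos.trans hR
  set B := Metric.ball (0 : Phase d) R
  have hBm : MeasurableSet B := measurableSet_ball
  have hBv : volume B ≠ ∞ := measure_ball_lt_top.ne
  refine ⟨exists_isSpectralRep_locOp hd hA h1 hBm hBv, fun lam h hT => ?_⟩
  refine ⟨integrable_accCohen_sub hA h1 hBm hBv h, ?_⟩
  rw [hT.integral_norm_accCohen_sub hA h1 hBm hBv]
  obtain ⟨h0, hle, hF⟩ := hT.tsum_mul_one_sub hA h1 hBm hBv
  have hV := hT.hasSum_lam hA h1 hBm hBv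
  have hF0 : 0 ≤ ∑' k, lam k * (1 - lam k) :=
    tsum_nonneg fun k => mul_nonneg (h0 k) (by linarith [hle k])
  have hRp : 1 ≤ R ^ (2 * d - 1) := one_le_pow₀ hR.le
  have hlow : (b * m).toReal / 3 * R ^ (2 * d - 1) ≤ ∑' k, lam k * (1 - lam k) := by
    rw [← ENNReal.ofReal_le_ofReal_iff hF0, hF]
    calc ENNReal.ofReal ((b * m).toReal / 3 * R ^ (2 * d - 1))
        = ENNReal.ofReal (R ^ (2 * d - 1) / 3) * b * m := by
          rw [mul_assoc, ← ENNReal.ofReal_toReal (ENNReal.mul_ne_top hbt hmt),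
            ← ENNReal.ofReal_mul (by positivity), ENNReal.ofReal_toReal
            (ENNReal.mul_ne_top hbt hmt)]
          congr 1; ring
      _ = ∫⁻ w, ENNReal.ofReal (R ^ (2 * d - 1) / 3) * b *
            (sqTilde A w * ENNReal.ofReal (min ‖w‖ 1)) :=
          (lintegral_const_mul _ ((measurable_sqTilde A).mul (by fun_prop))).symm
      _ ≤ _ := lintegral_mono fun w => by
          have := le_measure_notMem_add_mem_ball (μ := volume) hfr hR.le w
          rw [Phase.finrank_eq, ENNReal.ofReal_mul (by positivity)] at this
          calc _ = sqTilde A w * (ENNReal.ofReal (R ^ (2 * d - 1) / 3) *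
                ENNReal.ofReal (min ‖w‖ 1) * b) := by ring
            _ ≤ _ := by gcongr
  have hupp : ∑' k, lam k * (1 - lam k) ≤ 2 * d * (b * M).toReal * R ^ (2 * d - 1) := by
    rw [← ENNReal.ofReal_le_ofReal_iff (by positivity), hF]
    calc _ ≤ ∫⁻ w, ENNReal.ofReal (2 * d * R ^ (2 * d - 1)) * b * (sqTilde A w * ‖w‖ₑ) :=
          lintegral_mono fun w => by
            have := measure_notMem_add_mem_ball_le (μ := volume) hfr hR0 w
            rw [Phase.finrank_eq, ENNReal.ofReal_mul (by positivity), ofReal_norm] at this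
            push_cast at this
            calc _ ≤ sqTilde A w * (ENNReal.ofReal (2 * d * R ^ (2 * d - 1)) * ‖w‖ₑ * b) := by
                  gcongr
              _ = _ := by ring
      _ = ENNReal.ofReal (2 * d * R ^ (2 * d - 1)) * b * M :=
          lintegral_const_mul _ ((measurable_sqTilde A).mul (by fun_prop))
      _ = ENNReal.ofReal (2 * d * (b * M).toReal * R ^ (2 * d - 1)) := by
          rw [mul_assoc, ← ENNReal.ofReal_toReal (ENNReal.mul_ne_top hbt hMt),
            ← ENNReal.ofReal_mul (by positivity), ENNReal.ofReal_toReal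
            (ENNReal.mul_ne_top hbt hMt)]
          congr 1; ring
      _ ≤ _ := le_rfl
  refine ⟨hlow.trans (tsum_mul_one_sub_le h0 hle hV _), ?_⟩
  refine (le_two_mul_tsum_mul_one_sub hT.antitone h0 hle hV (Nat.le_ceil _)).trans ?_
  have hceil := (Nat.ceil_lt_add_one (a := volume.real B) measureReal_nonneg).le
  linarith
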